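/- **Setting.** Let $X=\mathbb R^m$ with the Euclidean distance $d_X$, let $(\mathcal A,d_A)$ be a locally compact separable metric space, and let $X_t\subseteq X$ ($t\in\mathbb N$) be non-empty locally compact Borel sets. A finite-horizon MDP $M=((\{X_t\},X),\mathcal A,\psi,\{Q_t\},(c,h),T)$ consists further of non-empty measurable sets $\psi(x)\subseteq\mathcal A$ of feasible controls such that $\mathbb K=\{(x,a):x\in X,\ a\in\psi(x)\}$ and $\mathbb K_t=\{(x,a):x\in X_t,\ a\in\psi(x)\}$ are measurable, stochastic kernels $Q_t(\cdot\mid x,a)$ from $\mathbb K_t$ to $X_{t+1}$, measurable costs $c:\mathbb K\to\mathbb R$ and $h:X\to\mathbb R$, and a horizon $T\in\mathbb N$. A process without controls is one for which $\mathcal A$ is a single point. The optimal cost-to-go functions are $J_T=h$ on $X_T$ and, for $t<T$ and $x\in X_t$, $$J_t(x)=\inf_{a\in\psi(x)}\Big\{c(x,a)+\int_{X_{t+1}}J_{t+1}(y)\,Q_t(dy\mid x,a)\Big\}.$$ Write $\zeta_{v,t}(x,a)=\int_{X_{t+1}}v\,dQ_t(\cdot\mid x,a)$. $M$ is *approximable*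 if the following hold. 1. $X=\mathbb R^m$. 2. $\psi(x)$ is compact for every $x$. 3. $d_H(\psi(x),\psi(y))\le L_\psi\, d_X(x,y)$ for some $L_\psi>0$, where $d_H$ is the Hausdorff distance. 4. $c$ is Lipschitz on $\mathbb K$ with respect to $d_X+d_A$. Moreover $h=h_1+h_2$, where $h_1$ is Lipschitz and $h_2=f_1$ on $O$, $h_2=f_2$ on $X\setminus O$, with $f_1,f_2$ bounded and Lipschitz on $X$ and $O$ one of the orthants $\{x\le b\}$, $\{x<b\}$ (componentwise) for some $b\in\mathbb R^m$. There are a lower semicontinuous $w:X\to(0,\infty)$ and $\bar c>0$ with $|h_1(x)|+\max\{\|f_1\|_\infty,\|f_2\|_\infty\}+\sup_{a\in\psi(x)}|c(x,a)|<\bar c\,w(x)$ for all $x$. 5. For every $t$, $\zeta_{w,t}$ is finite and upper semicontinuous on $\mathbb K_t$, and for some $\bar d>0$, $\zeta_{w,t}(x,a)\le\bar d\,w(x)$ for all $t$ and all $(x,a)\in\mathbb K_t$. 6. For every bounded continuous $v:X\to\mathbb R$ and every $t$, $\zeta_{v,t}$ is continuous on $\mathbb K_t$. 7. There is $L_q>0$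 such that $|\zeta_{v,t}(x,a)-\zeta_{v,t}(y,a')|\le L_qL_v\,(d_X(x,y)+d_A(a,a'))$ for all $t$, all $(x,a),(y,a')\in\mathbb K_t$ and all functions $v:X\to\mathbb R$ that are Lipschitz with constant $L_v$ and integrable with respect to $Q_t(\cdot\mid x,a)$ and $Q_t(\cdot\mid y,a')$. 8. If $T\ge1$: for every $\theta>0$ there is $\Lambda>0$ such that for all $\lambda>\Lambda$ and all $(x,a)\in\mathbb K_{T-1}$, $\int_{\mathcal R_{\lambda,b}}w(y)\,Q_{T-1}(dy\mid x,a)<\theta$. Here $g_{\lambda,b}(x)=\prod_{i=1}^m\max\{0,\min\{1,-\lambda(x_i-b_i)\}\}$ and $\mathcal R_{\lambda,b}=\{x:g_{\lambda,b}(x)\ne\mathbf 1_O(x)\}$. **Smoothing.** $\Phi_1(M,\lambda)$ is $M$ with terminal cost $h_1+\tilde h_\lambda$, where $\tilde h_\lambda=f_1g_{\lambda,b}+f_2(1-g_{\lambda,b})$; its cost-to-go functions are $\tilde J_t$. **Compact families.** $\mathbb H_{\tilde M,\alpha}$, with $\tilde M=\Phi_1(M,\lambda)$, is the set of families $\{H_t\}_{t=0}^T$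 of non-empty compact sets $H_t\subseteq X_t$ such that $\int_{X\setminus H_{t+1}}w(y)\,Q_t(dy\mid x,a)\le\alpha$ for all $t<T$, $x\in H_t$, $a\in\psi(x)$. (It does not depend on $\lambda$.) **Discretization.** A $\beta$-partition of a metric space $Y$ consists of finitely many points $x_i\in Y$ and disjoint sets $Y_i\ni x_i$ with union $Y$, such that $d(x,x_i)\le\beta$ for $x\in Y_i$; put $p(x)=x_i$ for $x\in Y_i$. Given any $\beta$-partitions $\Gamma_t$ of $H_t$ into Borel cells ($0\le t\le T$) and any $\eta$-partitions $\Theta_t(x)$ of $\psi(x)$ ($0\le t<T$, $x\in\Gamma_t$), the process $\Psi(M,\lambda,\beta,\eta,\{H_t\})$ has state spaces $\Gamma_t$, feasible controls $\Theta_t(x)$, transition weights $\hat Q_t(y\mid x,a)=Q_t(p^{-1}(y)\mid x,a)$ for $y\in\Gamma_{t+1}$, stage cost $c$, terminal cost $h_1+\tilde h_\lambda$ and horizon $T$. Its extended cost-to-go function $\hat J_t(x)$, $x\in H_t$, is the value at $p(x)\in\Gamma_t$ of its cost-to-go function, given by the same recursion. **Notation.** $\|v\|_w=\sup|v|/w$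 and $L_v$ is the smallest Lipschitz constant of $v$. For $v=J_t$ or $v=\tilde J_t$ both are taken over $X_t$; for $h_1$ and $\tilde h_\lambda$ the Lipschitz constant is taken over $X$, and $L_c$ is taken over $\mathbb K$ with respect to $d_X+d_A$. **Theorem.** Let $M$ be approximable, with $h_1,f_1,f_2,b,O,w,L_q$ as in 4, 5, 7 and 8. For all $\alpha,\beta,\eta,\theta>0$ there are $\{H_t\}_{t=0}^T\in\mathbb H_{\tilde M,\alpha}$ and $\Lambda>0$ such that for all $\lambda>\Lambda$: the functions $J_t$ and $\tilde J_t$ have finite $\|\cdot\|_w$ and $\tilde J_t$ is Lipschitz on $X_t$, for $0\le t\le T$; and for all partitions $\Gamma_t,\Theta_t(x)$ as above and all $t\in\{0,\dots,T-1\}$, $$\begin{aligned}\sup_{x\in H_t}|J_t(x)-\hat J_t(x)|\le{}&\theta\big\{\|J_T\|_w+\|\tilde J_T\|_w\big\}+\alpha\sum_{i=1}^{T-t}\|\tilde J_{t+i}\|_w+\eta\Big\{L_q\sum_{i=1}^{T-t}L_{\tilde J_{t+i}}+(T-t)L_c\Big\}\\&+\beta\Big\{L_{h_1}+L_{\tilde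 h_\lambda}+\sum_{i=1}^{T-t}L_{\tilde J_{t+i-1}}\Big\}.\end{aligned}$$ If $\mathcal A$ is a single point (no controls), the same holds with $\eta=0$. -/

import Mathlib

open MeasureTheory Set
open scoped NNReal

noncomputable section

namespace SmoothMDP

/-! ### Finite horizon Markov decision processes -/

/-- The raw tuple `(({X_t}, X), 𝒜, ψ, {Q_t}, (c, h), T)`. The feasible control sets carry a time
index because those of a discretized process do; they are constant in time in `IsMDP` below.
No law is imposed here: `Q t x a` of a truncated or discretized process is only sub-stochastic. -/
structure MDPTuple (X : Type*) [MeasurableSpace X] (𝒜 : Type*) where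
  /-- the state space `X_t` at time `t` -/
  S : ℕ → Set X
  /-- the feasible controls in state `x` at time `t` -/
  ψ : ℕ → X → Set 𝒜
  /-- the transition law `Q_t(· | x, a)` -/
  Q : ℕ → X → 𝒜 → Measure X
  /-- the cost per stage -/
  c : X → 𝒜 → ℝ
  /-- the terminal cost -/
  h : X → ℝ
  /-- the terminal time -/
  T : ℕ

namespace MDPTuple

variable {X : Type*} [MeasurableSpace X] {𝒜 : Type*}

/-- `𝕂_t = {(x, a) : x ∈ X_t, a ∈ ψ(x)}`. -/
def K (M : MDPTuple X 𝒜) (t : ℕ) : Set (X × 𝒜) := {p | p.1 ∈ M.S t ∧ p.2 ∈ M.ψ t p.1}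

/-- `𝕂 = {(x, a) : x ∈ X, a ∈ ψ(x)}` (used for processes whose `ψ` is constant in time). -/
def Kfull (M : MDPTuple X 𝒜) : Set (X × 𝒜) := {p | p.2 ∈ M.ψ 0 p.1}

/-- `ζ_{v,t}(x, a) = ∫_{X_{t+1}} v(y) Q_t(dy | x, a)`. -/
def zeta (M : MDPTuple X 𝒜) (v : X → ℝ) (t : ℕ) (p : X × 𝒜) : ℝ :=
  ∫ y in M.S (t + 1), v y ∂(M.Q t p.1 p.2)

/-- The optimal cost-to-go functions, by the backward Bellman recursion: `J_T = h` and, for `t < T`,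
`J_t(x) = inf_{a ∈ ψ(x)} (c(x, a) + ∫_{X_{t+1}} J_{t+1}(y) Q_t(dy | x, a))`.
Only the values of `J_t` on `X_t` are meaningful. -/
def J (M : MDPTuple X 𝒜) (t : ℕ) : X → ℝ :=
  if t < M.T then
    fun x => ⨅ a : M.ψ t x, (M.c x a + ∫ y in M.S (t + 1), M.J (t + 1) y ∂(M.Q t x a))
  else M.h
termination_by M.T - t

theorem J_terminal (M : MDPTuple X 𝒜) : M.J M.T = M.h := by
  rw [J]; simp

theorem J_bellman (M : MDPTuple X 𝒜) {t : ℕ} (ht : t < M.T) (x : X) :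
    M.J t x =
      ⨅ a : M.ψ t x, (M.c x a + ∫ y in M.S (t + 1), M.J (t + 1) y ∂(M.Q t x a)) := by
  rw [J]; simp [ht]

/-- A finite horizon Markov decision process. A process without controls is one whose control
space is a single point, so that `𝕂 = X` and `𝕂_t = X_t`. -/
structure IsMDP [TopologicalSpace X] [MeasurableSpace 𝒜] (M : MDPTuple X 𝒜) : Prop where
  stationary : ∀ s t, M.ψ s = M.ψ t
  S_nonempty : ∀ t, (M.S t).Nonempty
  S_measurable : ∀ t, MeasurableSet (M.S t)
  S_locallyCompact : ∀ t, LocallyCompactSpace (M.S t)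
  ψ_nonempty : ∀ t x, (M.ψ t x).Nonempty
  ψ_measurable : ∀ t x, MeasurableSet (M.ψ t x)
  Kfull_measurable : MeasurableSet M.Kfull
  K_measurable : ∀ t, MeasurableSet (M.K t)
  Q_probability : ∀ t, ∀ p ∈ M.K t, IsProbabilityMeasure (M.Q t p.1 p.2)
  Q_support : ∀ t, ∀ p ∈ M.K t, M.Q t p.1 p.2 (M.S (t + 1))ᶜ = 0
  Q_measurable : ∀ t, ∀ B : Set X, MeasurableSet B →
    Measurable fun p : M.K t => M.Q t p.1.1 p.1.2 B
  c_measurable : Measurable fun p : M.Kfull => M.c p.1.1 p.1.2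
  h_measurable : Measurable M.h

end MDPTuple

/-! ### Norms and Lipschitz constants -/

/-- The smallest Lipschitz constant of `f` on `s`. -/
def lipConst {X : Type*} [PseudoMetricSpace X] (s : Set X) (f : X → ℝ) : ℝ≥0 :=
  sInf {L : ℝ≥0 | LipschitzOnWith L f s}

/-- `L` is a Lipschitz constant on `s` of a function of a state and a control, with respect to
the distance `d_X + d_A`. -/
def IsLipConst₂ {X 𝒜 : Type*} [PseudoMetricSpace X] [PseudoMetricSpace 𝒜] (s : Set (X × 𝒜))
    (f : X → 𝒜 → ℝ) (L : ℝ≥0) : Prop :=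
  ∀ p ∈ s, ∀ q ∈ s, |f p.1 p.2 - f q.1 q.2| ≤ L * (dist p.1 q.1 + dist p.2 q.2)

/-- The smallest such constant. -/
def lipConst₂ {X 𝒜 : Type*} [PseudoMetricSpace X] [PseudoMetricSpace 𝒜] (s : Set (X × 𝒜))
    (f : X → 𝒜 → ℝ) : ℝ≥0 :=
  sInf {L : ℝ≥0 | IsLipConst₂ s f L}

/-- The weighted norm `‖v‖_w = sup |v| / w` over `s` is finite. -/
def FiniteWNorm {X : Type*} (s : Set X) (w v : X → ℝ) : Prop :=
  BddAbove ((fun x => |v x| / w x) '' s)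

/-- The weighted norm `‖v‖_w = sup |v| / w` over `s`. -/
def wNorm {X : Type*} (s : Set X) (w v : X → ℝ) : ℝ :=
  sSup ((fun x => |v x| / w x) '' s)

/-! ### Smoothing -/

variable {m : ℕ}

/-- The smoothed indicator `g_{λ,b}`, a product over the coordinates of the continuous piecewise
linear functions that are `1` for `x_i ≤ b_i - 1/λ`, `0` for `x_i ≥ b_i` and
`-λ (x_i - b_i)` in between. -/
def smoothInd (lam : ℝ) (b x : EuclideanSpace ℝ (Fin m)) : ℝ :=
  ∏ i, max 0 (min 1 (-lam * (x i - b i)))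

/-- The objects in terms of which the properties of an approximable process are phrased. -/
structure ApproxData (m : ℕ) where
  /-- the Lipschitz part of the terminal cost -/
  h₁ : EuclideanSpace ℝ (Fin m) → ℝ
  /-- the discontinuous part of the terminal cost inside the orthant -/
  f₁ : EuclideanSpace ℝ (Fin m) → ℝ
  /-- the discontinuous part of the terminal cost outside the orthant -/
  f₂ : EuclideanSpace ℝ (Fin m) → ℝ
  /-- the vertex of the orthant -/
  b : EuclideanSpace ℝ (Fin m)
  /-- the orthant, `{x ≤ b}` or `{x < b}` -/
  O : Set (EuclideanSpace ℝ (Fin m))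
  /-- the weight -/
  w : EuclideanSpace ℝ (Fin m) → ℝ
  /-- the Lipschitz constant of the transition law -/
  Lq : ℝ

namespace ApproxData

open Classical in
/-- `h₂ = f₁` on the orthant and `h₂ = f₂` off it. -/
def h₂ (D : ApproxData m) (x : EuclideanSpace ℝ (Fin m)) : ℝ :=
  if x ∈ D.O then D.f₁ x else D.f₂ x

/-- `h̃_λ = f₁ g_{λ,b} + f₂ (1 - g_{λ,b})`. -/
def hTilde (D : ApproxData m) (lam : ℝ) (x : EuclideanSpace ℝ (Fin m)) : ℝ :=
  D.f₁ x * smoothInd lam D.b x + D.f₂ x * (1 - smoothInd lam D.b x)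

/-- The region of smoothing: where `g_{λ,b}` differs from the indicator of the orthant. -/
def region (D : ApproxData m) (lam : ℝ) : Set (EuclideanSpace ℝ (Fin m)) :=
  {x | smoothInd lam D.b x ≠ D.O.indicator (fun _ => (1 : ℝ)) x}

end ApproxData

/-- Approximable processes on `X = ℝ^m`, with witnesses `D` for the existential parts of the
defining properties. -/
structure IsApproximable {𝒜 : Type*} [MetricSpace 𝒜] [MeasurableSpace 𝒜]
    (M : MDPTuple (EuclideanSpace ℝ (Fin m)) 𝒜) (D : ApproxData m) : Prop where
  isMDP : M.IsMDP
  ψ_compact : ∀ t x, IsCompact (M.ψ t x)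
  ψ_lipschitz : ∃ Lψ : ℝ, 0 < Lψ ∧
    ∀ t x y, Metric.hausdorffDist (M.ψ t x) (M.ψ t y) ≤ Lψ * dist x y
  c_lipschitz : ∃ L : ℝ≥0, IsLipConst₂ M.Kfull M.c L
  O_eq : D.O = {x | ∀ i, x i ≤ D.b i} ∨ D.O = {x | ∀ i, x i < D.b i}
  h_eq : ∀ x, M.h x = D.h₁ x + D.h₂ x
  h₁_lipschitz : ∃ L : ℝ≥0, LipschitzWith L D.h₁
  f₁_lipschitz : ∃ L : ℝ≥0, LipschitzWith L D.f₁
  f₂_lipschitz : ∃ L : ℝ≥0, LipschitzWith L D.f₂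
  f₁_bounded : BddAbove (range fun x => |D.f₁ x|)
  f₂_bounded : BddAbove (range fun x => |D.f₂ x|)
  w_pos : ∀ x, 0 < D.w x
  w_lsc : LowerSemicontinuous D.w
  w_dominates : ∃ cbar : ℝ, 0 < cbar ∧ ∀ x, ∀ a ∈ M.ψ 0 x,
    |D.h₁ x| + max (⨆ y, |D.f₁ y|) (⨆ y, |D.f₂ y|) + |M.c x a| < cbar * D.w x
  w_integrable : ∀ t, ∀ p ∈ M.K t, Integrable D.w (M.Q t p.1 p.2)
  zeta_w_usc : ∀ t, UpperSemicontinuousOn (M.zeta D.w t) (M.K t)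
  zeta_w_le : ∃ dbar : ℝ, 0 < dbar ∧ ∀ t, ∀ p ∈ M.K t, M.zeta D.w t p ≤ dbar * D.w p.1
  feller : ∀ v : EuclideanSpace ℝ (Fin m) → ℝ, Continuous v → (∃ C, ∀ x, |v x| ≤ C) →
    ∀ t, ContinuousOn (M.zeta v t) (M.K t)
  Lq_pos : 0 < D.Lq
  zeta_lipschitz : ∀ t, ∀ p ∈ M.K t, ∀ q ∈ M.K t,
    ∀ (v : EuclideanSpace ℝ (Fin m) → ℝ) (Lv : ℝ≥0), LipschitzWith Lv v →
    Integrable v (M.Q t p.1 p.2) → Integrable v (M.Q t q.1 q.2) →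
      |M.zeta v t p - M.zeta v t q| ≤ D.Lq * Lv * (dist p.1 q.1 + dist p.2 q.2)
  region_small : ∀ θ : ℝ, 0 < θ → ∃ Λ : ℝ, 0 < Λ ∧ ∀ lam : ℝ, Λ < lam →
    ∀ t, t + 1 = M.T → ∀ p ∈ M.K t, ∫ y in D.region lam, D.w y ∂(M.Q t p.1 p.2) < θ

/-- `Φ₁(M, λ)`: the smoothed process, with terminal cost `h₁ + h̃_λ`. -/
def Phi₁ {𝒜 : Type*} (M : MDPTuple (EuclideanSpace ℝ (Fin m)) 𝒜) (D : ApproxData m) (lam : ℝ) :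
    MDPTuple (EuclideanSpace ℝ (Fin m)) 𝒜 :=
  { M with h := fun x => D.h₁ x + D.hTilde lam x }

/-! ### Discretization -/

/-- The families `{H_t}` of non-empty compact sets `H_t ⊆ X_t`, `t ∈ {0, …, T}`, outside of which
the `w`-weighted transition laws from the preceding set have mass at most `α`. -/
def compactFamilies {X : Type*} [MeasurableSpace X] [TopologicalSpace X] {𝒜 : Type*}
    (M : MDPTuple X 𝒜) (w : X → ℝ) (α : ℝ) : Set (ℕ → Set X) :=
  {H | (∀ t ≤ M.T, (H t).Nonempty ∧ IsCompact (H t) ∧ H t ⊆ M.S t) ∧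
    ∀ t < M.T, ∀ x ∈ H t, ∀ a ∈ M.ψ t x, ∫ y in (H (t + 1))ᶜ, w y ∂(M.Q t x a) ≤ α}

/-- Finitely many points together with a map that sends each element to the point of its cell. -/
structure PartitionData (Z : Type*) where
  /-- the points `x_1, …, x_n` -/
  pts : Finset Z
  /-- the projection: `proj x = x_i` if `x` lies in the `i`-th cell -/
  proj : Z → Z

/-- The cell `p⁻¹(y)` of the point `y` in `Y`. -/
def PartitionData.cell {Z : Type*} (P : PartitionData Z) (Y : Set Z) (y : Z) : Set Z :=
  {x | x ∈ Y ∧ P.proj x = y}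

/-- `P` is a `β`-partition of `Y`: the cells of its points are disjoint with union `Y`, each point
lies in its own cell, and every element of a cell is within `β` of the point of the cell. -/
structure IsPartition {Z : Type*} [MetricSpace Z] (Y : Set Z) (β : ℝ) (P : PartitionData Z) :
    Prop where
  pts_subset : ∀ y ∈ P.pts, y ∈ Y
  proj_pts : ∀ y ∈ P.pts, P.proj y = y
  proj_mem : ∀ x ∈ Y, P.proj x ∈ P.pts
  dist_le : ∀ x ∈ Y, dist x (P.proj x) ≤ β

/-- `Φ₂({H_t}, M)`: the process with state spaces `H_t`. -/
def Phi₂ {X : Type*} [MeasurableSpace X] {𝒜 : Type*} (H : ℕ → Set X) (M : MDPTuple X 𝒜) :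
    MDPTuple X 𝒜 :=
  { M with S := H }

/-- `Φ₃`: the discretization with state spaces `Γ_t`, feasible controls `Θ_t(x)`, and transition
probabilities `Q̂_t(y | x, a) = Q_t(p⁻¹(y) | x, a)` for `y ∈ Γ_{t+1}`. -/
def Phi₃ {X : Type*} [MeasurableSpace X] {𝒜 : Type*} (Γ : ℕ → PartitionData X)
    (Θ : ℕ → X → PartitionData 𝒜) (M : MDPTuple X 𝒜) : MDPTuple X 𝒜 :=
  { M with
    S := fun t => (Γ t).pts
    ψ := fun t x => (Θ t x).pts
    Q := fun t x a => ∑ y ∈ (Γ (t + 1)).pts,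
      M.Q t x a ((Γ (t + 1)).cell (M.S (t + 1)) y) • Measure.dirac y }

/-- The total approximation map `Ψ = Φ₃ ∘ Φ₂ ∘ Φ₁`. -/
def Psi {𝒜 : Type*} (M : MDPTuple (EuclideanSpace ℝ (Fin m)) 𝒜) (D : ApproxData m) (lam : ℝ)
    (H : ℕ → Set (EuclideanSpace ℝ (Fin m))) (Γ : ℕ → PartitionData (EuclideanSpace ℝ (Fin m)))
    (Θ : ℕ → EuclideanSpace ℝ (Fin m) → PartitionData 𝒜) :
    MDPTuple (EuclideanSpace ℝ (Fin m)) 𝒜 :=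
  Phi₃ Γ Θ (Phi₂ H (Phi₁ M D lam))

/-- `Γ_t` is a `β`-partition of `H_t` into Borel cells for `t ∈ {0, …, T}`, and `Θ_t(x)` is an
`η`-partition of `ψ(x)` for `x ∈ Γ_t`, `t ∈ {0, …, T - 1}`. -/
structure IsDiscretization {X : Type*} [MetricSpace X] [MeasurableSpace X] {𝒜 : Type*}
    [MetricSpace 𝒜] (M : MDPTuple X 𝒜) (H : ℕ → Set X) (β η : ℝ)
    (Γ : ℕ → PartitionData X) (Θ : ℕ → X → PartitionData 𝒜) : Prop where
  state : ∀ t ≤ M.T, IsPartition (H t) β (Γ t)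
  state_measurable : ∀ t ≤ M.T, ∀ y ∈ (Γ t).pts, MeasurableSet ((Γ t).cell (H t) y)
  control : ∀ t < M.T, ∀ x ∈ (Γ t).pts, IsPartition (M.ψ t x) η (Θ t x)

/-- The extended cost-to-go function `x ↦ Ĵ_t(p(x))` of a process with state spaces `Γ_t`. -/
def extendedJ {X : Type*} [MeasurableSpace X] {𝒜 : Type*} (Γ : ℕ → PartitionData X)
    (M : MDPTuple X 𝒜) (t : ℕ) (x : X) : ℝ :=
  M.J t ((Γ t).proj x)

end SmoothMDP

end

/-!
The error splits as `J_t - Ĵ_t = (J_t - J̃_t) + (J̃_t - Ĵ_t)`, where `J̃_t` belongs to the process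
with the smoothed terminal cost, and each part is controlled by a backward induction through the
Bellman operator, which does not increase uniform errors in the integrals.

*Smoothing.* The two terminal costs differ only in the region of smoothing, which has small
`w`-weighted mass under `Q_{T-1}`. This bounds `J_{T-1} - J̃_{T-1}` uniformly, and the bound is
passed on to earlier times because the laws are probability measures (`abs_J_sub_J_Phi₁_le`).
The functions `J̃_t` are Lipschitz, since the minimized costs are Lipschitz on `𝕂_t` and the
control sets vary in a Lipschitz way (`exists_lipschitzOnWith_bellman`); in particular `J_t` with
`t < T` is a limit of Lipschitz functions on `X_t`, hence measurable there.

*Compact sets.* `H_{t+1}` is obtained from `H_t` by uniform tightness of the measures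
`w dQ_t(· | x, a)` over the compact set of all `(x, a)` with `x ∈ H_t`, `a ∈ ψ(x)`
(`exists_isCompact_setIntegral_compl_le`). The weight is approximated from below by a bounded
continuous `v` whose support, relative to the closure of `X_{t+1}`, is a compact subset of the
locally closed set `X_{t+1}`. By the Feller property and the upper semicontinuity of `ζ_w`, the
difference `ζ_w - ζ_v` stays small near a point at which it is small; finitely many neighbourhoods
suffice.

*Discretization.* Going from `t + 1` to `t` the error of `Ĵ` grows by `β L_{J̃_t}` (moving the
state to the point of its cell), by `η (L_q L_{J̃_{t+1}} + L_c)` (moving the control) and by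
`α ‖J̃_{t+1}‖_w` (discarding the mass outside `H_{t+1}`); see `abs_J_Phi₁_sub_extendedJ_succ_le`.
-/

namespace SmoothMDP

open Filter Topology

variable {m : ℕ}

/-! ### Infima, Lipschitz constants and weighted norms -/

theorem abs_iInf_sub_iInf_le {ι κ : Type*} [Nonempty ι] [Nonempty κ] {f : ι → ℝ} {g : κ → ℝ}
    {ε : ℝ} (hf : BddBelow (range f)) (hg : BddBelow (range g))
    (hfg : ∀ i, ∃ j, g j ≤ f i + ε) (hgf : ∀ j, ∃ i, f i ≤ g j + ε) :
    |iInf f - iInf g| ≤ ε := by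
  rw [abs_sub_le_iff]
  constructor
  · have : iInf f - ε ≤ iInf g := le_ciInf fun j => by
      obtain ⟨i, hi⟩ := hgf j
      linarith [ciInf_le hf i]
    linarith
  · have : iInf g - ε ≤ iInf f := le_ciInf fun i => by
      obtain ⟨j, hj⟩ := hfg i
      linarith [ciInf_le hg j]
    linarith

/-- Closed linear inequalities pass to the infimum, so that smallest Lipschitz constants are
attained. -/
theorem le_sInf_mul {A : Set ℝ≥0} (hA : A.Nonempty) {r d : ℝ} (h : ∀ L ∈ A, r ≤ L * d) :
    r ≤ (sInf A : ℝ≥0) * d := by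
  have hcl : IsClosed {L : ℝ≥0 | r ≤ L * d} :=
    isClosed_le continuous_const (NNReal.continuous_coe.mul continuous_const)
  exact closure_minimal h hcl (csInf_mem_closure hA (OrderBot.bddBelow _))

/-- The smallest Lipschitz constant is one, provided that there is any. -/
theorem lipschitzOnWith_lipConst {X : Type*} [PseudoMetricSpace X] {s : Set X} {f : X → ℝ}
    (h : ∃ L : ℝ≥0, LipschitzOnWith L f s) : LipschitzOnWith (lipConst s f) f s :=
  LipschitzOnWith.of_dist_le_mul fun x hx y hy =>
    le_sInf_mul h fun _ hL => LipschitzOnWith.dist_le_mul hL x hx y hy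

theorem isLipConst₂_lipConst₂ {X 𝒜 : Type*} [PseudoMetricSpace X] [PseudoMetricSpace 𝒜]
    {s : Set (X × 𝒜)} {f : X → 𝒜 → ℝ} (h : ∃ L : ℝ≥0, IsLipConst₂ s f L) :
    IsLipConst₂ s f (lipConst₂ s f) :=
  fun p hp q hq => le_sInf_mul h fun _ hL => hL p hp q hq

theorem finiteWNorm_of_le {X : Type*} {s : Set X} {w v : X → ℝ} (hw : ∀ x, 0 < w x) {C : ℝ}
    (h : ∀ x ∈ s, |v x| ≤ C * w x) : FiniteWNorm s w v := by
  refine ⟨C, ?_⟩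
  rintro _ ⟨x, hx, rfl⟩
  exact (div_le_iff₀ (hw x)).2 (h x hx)

theorem FiniteWNorm.abs_le {X : Type*} {s : Set X} {w v : X → ℝ} (hw : ∀ x, 0 < w x)
    (h : FiniteWNorm s w v) {x : X} (hx : x ∈ s) : |v x| ≤ wNorm s w v * w x :=
  (div_le_iff₀ (hw x)).1 (le_csSup h ⟨x, hx, rfl⟩)

theorem wNorm_nonneg {X : Type*} {s : Set X} {w v : X → ℝ} (hw : ∀ x, 0 < w x) :
    0 ≤ wNorm s w v := by
  refine Real.sSup_nonneg ?_
  rintro _ ⟨x, -, rfl⟩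
  exact div_nonneg (abs_nonneg _) (hw x).le

theorem wNorm_le {X : Type*} {s : Set X} {w v : X → ℝ} (hw : ∀ x, 0 < w x) (hs : s.Nonempty)
    {C : ℝ} (h : ∀ x ∈ s, |v x| ≤ C * w x) : wNorm s w v ≤ C := by
  refine csSup_le (hs.image _) ?_
  rintro _ ⟨x, hx, rfl⟩
  exact (div_le_iff₀ (hw x)).2 (h x hx)

/-! ### The smoothed terminal cost -/

/-- Products of bounded Lipschitz functions are Lipschitz. -/
theorem exists_lipschitzWith_mul {X : Type*} [PseudoMetricSpace X] {f g : X → ℝ} {A B : ℝ}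
    (hf : ∃ L : ℝ≥0, LipschitzWith L f) (hg : ∃ L : ℝ≥0, LipschitzWith L g)
    (hA : ∀ x, |f x| ≤ A) (hB : ∀ x, |g x| ≤ B) :
    ∃ L : ℝ≥0, LipschitzWith L fun x => f x * g x := by
  obtain ⟨Lf, hf⟩ := hf
  obtain ⟨Lg, hg⟩ := hg
  refine ⟨A.toNNReal * Lg + B.toNNReal * Lf, LipschitzWith.of_dist_le_mul fun x y => ?_⟩
  have h1 := hf.dist_le_mul x y
  have h2 := hg.dist_le_mul x y
  rw [Real.dist_eq] at h1 h2 ⊢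
  have e : f x * g x - f y * g y = f x * (g x - g y) + g y * (f x - f y) := by ring
  have hA' : |f x| ≤ A.toNNReal := (hA x).trans (Real.le_coe_toNNReal A)
  have hB' : |g y| ≤ B.toNNReal := (hB y).trans (Real.le_coe_toNNReal B)
  calc |f x * g x - f y * g y| ≤ |f x| * |g x - g y| + |g y| * |f x - f y| := by
        rw [e, ← abs_mul, ← abs_mul]
        exact abs_add_le _ _
    _ ≤ A.toNNReal * (Lg * dist x y) + B.toNNReal * (Lf * dist x y) := by gcongr
    _ = _ := by push_cast; ring

theorem smoothInd_mem_Icc (lam : ℝ) (b x : EuclideanSpace ℝ (Fin m)) :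
    smoothInd lam b x ∈ Icc (0 : ℝ) 1 :=
  ⟨Finset.prod_nonneg fun _ _ => le_max_left _ _,
    Finset.prod_le_one (fun _ _ => le_max_left _ _)
      fun _ _ => max_le zero_le_one (min_le_left _ _)⟩

theorem exists_lipschitzWith_smoothInd (lam : ℝ) (b : EuclideanSpace ℝ (Fin m)) :
    ∃ L : ℝ≥0, LipschitzWith L (smoothInd lam b) := by
  have key : ∀ s : Finset (Fin m), ∃ L : ℝ≥0, LipschitzWith L
      fun x : EuclideanSpace ℝ (Fin m) => ∏ i ∈ s, max 0 (min 1 (-lam * (x i - b i))) := by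
    intro s
    induction s using Finset.induction_on with
    | empty => exact ⟨0, LipschitzWith.const (1 : ℝ)⟩
    | insert i s his ih =>
      simp only [Finset.prod_insert his]
      refine exists_lipschitzWith_mul (A := 1) (B := 1) ⟨‖lam‖₊, ?_⟩ ih (fun x => ?_) fun x => ?_
      · refine LipschitzWith.const_max (LipschitzWith.const_min ?_ 1) 0
        refine LipschitzWith.of_dist_le_mul fun x y => ?_
        have h := PiLp.norm_apply_le (x - y) i
        rw [Real.dist_eq, dist_eq_norm]
        have e : -lam * (x i - b i) - -lam * (y i - b i) = -lam * ((x - y) i) := by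
          simp; ring
        rw [e, abs_mul, abs_neg, coe_nnnorm, Real.norm_eq_abs]
        exact mul_le_mul_of_nonneg_left h (abs_nonneg _)
      · rw [abs_of_nonneg (le_max_left _ _)]
        exact max_le zero_le_one (min_le_left _ _)
      · rw [abs_of_nonneg (Finset.prod_nonneg fun _ _ => le_max_left _ _)]
        exact Finset.prod_le_one (fun _ _ => le_max_left _ _)
          fun _ _ => max_le zero_le_one (min_le_left _ _)
  exact key Finset.univ

namespace IsApproximable

variable {𝒜 : Type*} [MetricSpace 𝒜] [MeasurableSpace 𝒜]
  {M : MDPTuple (EuclideanSpace ℝ (Fin m)) 𝒜} {D : ApproxData m}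

theorem exists_lipschitzWith_hTilde (hM : IsApproximable M D) (lam : ℝ) :
    ∃ L : ℝ≥0, LipschitzWith L (D.hTilde lam) := by
  have hg := exists_lipschitzWith_smoothInd lam D.b
  obtain ⟨Lg, hLg⟩ := hg
  have hg' : ∃ L : ℝ≥0, LipschitzWith L fun x => 1 - smoothInd lam D.b x :=
    ⟨0 + Lg, (LipschitzWith.const 1).sub hLg⟩
  obtain ⟨L₁, h₁⟩ := exists_lipschitzWith_mul (B := 1) hM.f₁_lipschitz ⟨Lg, hLg⟩
    (fun x => le_ciSup hM.f₁_bounded x)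
    fun x => by
      obtain ⟨h0, h1⟩ := smoothInd_mem_Icc lam D.b x
      exact abs_le.2 ⟨by linarith, h1⟩
  obtain ⟨L₂, h₂⟩ := exists_lipschitzWith_mul (B := 1) hM.f₂_lipschitz hg'
    (fun x => le_ciSup hM.f₂_bounded x)
    fun x => by
      obtain ⟨h0, h1⟩ := smoothInd_mem_Icc lam D.b x
      exact abs_le.2 ⟨by linarith, by linarith⟩
  exact ⟨L₁ + L₂, h₁.add h₂⟩

/-- One constant dominates the stage cost, the terminal cost and all smoothed terminal costs; that
it does not depend on `λ` is what makes the smoothing error small as `λ` grows. -/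
theorem exists_abs_terminal_le (hM : IsApproximable M D) :
    ∃ C : ℝ, 0 < C ∧ (∀ x, ∀ a ∈ M.ψ 0 x, |M.c x a| ≤ C * D.w x) ∧
      (∀ x, |M.h x| ≤ C * D.w x) ∧
      ∀ lam x, |D.h₁ x + D.hTilde lam x| ≤ C * D.w x := by
  obtain ⟨C, hC, h⟩ := hM.w_dominates
  have hf₁ : ∀ x, |D.f₁ x| ≤ max (⨆ y, |D.f₁ y|) (⨆ y, |D.f₂ y|) := fun x =>
    (le_ciSup hM.f₁_bounded x).trans (le_max_left _ _)
  have hf₂ : ∀ x, |D.f₂ x| ≤ max (⨆ y, |D.f₁ y|) (⨆ y, |D.f₂ y|) := fun x =>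
    (le_ciSup hM.f₂_bounded x).trans (le_max_right _ _)
  have hsum : ∀ x, |D.h₁ x| + max (⨆ y, |D.f₁ y|) (⨆ y, |D.f₂ y|) ≤ C * D.w x := by
    intro x
    obtain ⟨a, ha⟩ := hM.isMDP.ψ_nonempty 0 x
    linarith [h x a ha, abs_nonneg (M.c x a)]
  refine ⟨C, hC, fun x a ha => ?_, fun x => ?_, fun lam x => ?_⟩
  · linarith [h x a ha, abs_nonneg (D.h₁ x), hf₁ x, abs_nonneg (D.f₁ x)]
  · rw [hM.h_eq]
    refine (abs_add_le _ _).trans (le_trans ?_ (hsum x))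
    gcongr
    unfold ApproxData.h₂
    split_ifs
    exacts [hf₁ x, hf₂ x]
  · refine (abs_add_le _ _).trans (le_trans ?_ (hsum x))
    gcongr
    obtain ⟨h0, h1⟩ := smoothInd_mem_Icc lam D.b x
    unfold ApproxData.hTilde
    refine (abs_add_le _ _).trans ?_
    rw [abs_mul, abs_mul, abs_of_nonneg h0, abs_of_nonneg (sub_nonneg.2 h1)]
    have := mul_le_mul_of_nonneg_right (hf₁ x) h0
    have := mul_le_mul_of_nonneg_right (hf₂ x) (sub_nonneg.2 h1)
    linarith

/-- Off the region of smoothing the two terminal costs agree. -/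
theorem h_eq_of_notMem_region (hM : IsApproximable M D) {lam : ℝ}
    {x : EuclideanSpace ℝ (Fin m)} (hx : x ∉ D.region lam) :
    M.h x = D.h₁ x + D.hTilde lam x := by
  have hx' : smoothInd lam D.b x = D.O.indicator (fun _ => (1 : ℝ)) x := by
    simpa [ApproxData.region] using hx
  rw [hM.h_eq, ApproxData.h₂, ApproxData.hTilde, hx']
  by_cases hO : x ∈ D.O <;> simp [hO]

theorem measurableSet_region (hM : IsApproximable M D) (lam : ℝ) :
    MeasurableSet (D.region lam) := by
  have hc : ∀ i, Continuous fun x : EuclideanSpace ℝ (Fin m) => x i := fun i => by fun_prop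
  have hO : MeasurableSet D.O := by
    rcases hM.O_eq with h | h <;> rw [h]
    · rw [ofPred_forall]
      exact MeasurableSet.iInter fun i => measurableSet_le (hc i).measurable measurable_const
    · rw [ofPred_forall]
      exact MeasurableSet.iInter fun i => measurableSet_lt (hc i).measurable measurable_const
  obtain ⟨L, hL⟩ := exists_lipschitzWith_smoothInd lam D.b
  exact (measurableSet_eq_fun hL.continuous.measurable
    (measurable_const.indicator hO)).compl

end IsApproximable

/-! ### Approximation of lower semicontinuous functions from below -/

/-- A locally compact subset of a Hausdorff space is locally closed. -/
theorem exists_isOpen_inter_closure_subset {X : Type*} [TopologicalSpace X] [T2Space X]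
    (S : Set X) [LocallyCompactSpace S] :
    ∃ U : Set X, IsOpen U ∧ S ⊆ U ∧ U ∩ closure S ⊆ S := by
  have key : ∀ x ∈ S, ∃ V : Set X, IsOpen V ∧ x ∈ V ∧ V ∩ closure S ⊆ S := by
    intro x hx
    obtain ⟨K, hK, hxK⟩ := exists_compact_mem_nhds (⟨x, hx⟩ : S)
    obtain ⟨N, hN, hNK⟩ := mem_nhds_induced _ _ _ |>.1 hxK
    obtain ⟨V, hVN, hV, hxV⟩ := mem_nhds_iff.1 hN
    refine ⟨V, hV, hxV, ?_⟩
    have hKc : IsCompact ((↑) '' K : Set X) := hK.image continuous_subtype_val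
    have hsub : V ∩ S ⊆ ((↑) '' K : Set X) := fun y hy =>
      ⟨⟨y, hy.2⟩, hNK (hVN hy.1), rfl⟩
    calc V ∩ closure S ⊆ closure (V ∩ S) := hV.inter_closure
      _ ⊆ ((↑) '' K : Set X) := closure_minimal hsub hKc.isClosed
      _ ⊆ S := by rintro _ ⟨y, -, rfl⟩; exact y.2
  choose! V hVo hxV hV using key
  refine ⟨⋃ x ∈ S, V x, isOpen_biUnion hVo, fun x hx => mem_biUnion hx (hxV x hx), ?_⟩
  rintro y ⟨hy, hyS⟩
  obtain ⟨x, hx, hy⟩ := mem_iUnion₂.1 hy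
  exact hV x hx ⟨hy, hyS⟩

/-- A positive lower semicontinuous function on an open set `U` is the pointwise limit from below
of bounded continuous non-negative functions, each vanishing off a compact subset of `U`. They are
truncations of the infimal convolutions of `w · 1_U` with `n · dist`: the term subtracted before
taking the positive part keeps the support inside `U`. -/
theorem exists_seq_continuous_tendsto_of_lowerSemicontinuous {E : Type*} [NormedAddCommGroup E]
    [ProperSpace E] {U : Set E} (hU : IsOpen U) {w : E → ℝ} (hw : LowerSemicontinuous w)
    (hpos : ∀ x, 0 < w x) :
    ∃ v : ℕ → E → ℝ, (∀ n, Continuous (v n)) ∧ (∀ n x, 0 ≤ v n x) ∧ (∀ n x, v n x ≤ w x) ∧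
      (∀ n, ∃ C, ∀ x, |v n x| ≤ C) ∧
      (∀ n, ∃ C : Set E, IsCompact C ∧ C ⊆ U ∧ ∀ x, x ∉ C → v n x = 0) ∧
      ∀ x ∈ U, Tendsto (fun n => v n x) atTop (𝓝 (w x)) := by
  set u : E → ℝ := U.indicator w with hu
  have hu0 : ∀ x, 0 ≤ u x := fun x => indicator_nonneg (fun y _ => (hpos y).le) x
  have huw : ∀ x, u x ≤ w x := fun x => indicator_le_self' (fun y _ => (hpos y).le) x
  set φ : ℕ → E → ℝ := fun n x => ⨅ y, (u y + n * dist x y) with hφ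
  have hbdd : ∀ (n : ℕ) x, BddBelow (range fun y => u y + n * dist x y) := fun n x =>
    ⟨0, by rintro _ ⟨y, rfl⟩; have := hu0 y; positivity⟩
  have hφu : ∀ n x, φ n x ≤ u x := fun n x => by
    simpa using ciInf_le (hbdd n x) x
  have hφc : ∀ n, Continuous (φ n) := fun n => by
    refine (LipschitzWith.of_le_add_mul (n : ℝ≥0) fun x y => ?_).continuous
    rw [← sub_le_iff_le_add]
    refine le_ciInf fun z => ?_
    have h1 : φ n x ≤ u z + n * dist x z := ciInf_le (hbdd n x) z
    have h2 : (n : ℝ) * dist x z ≤ n * (dist x y + dist y z) := by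
      gcongr
      exact dist_triangle _ _ _
    simp only [NNReal.coe_natCast]
    linarith
  have hn : ∀ n : ℕ, (0 : ℝ) < n + 1 := fun n => by positivity
  set v : ℕ → E → ℝ := fun n x => max 0 (min (n + 1 : ℝ) (φ n x) - (1 + ‖x‖) / (n + 1)) with hv
  have hfrac : ∀ (n : ℕ) (x : E), 0 < (1 + ‖x‖) / (n + 1 : ℝ) := fun n x => by positivity
  have hvw : ∀ n x, v n x ≤ w x := fun n x =>
    max_le (hpos x).le (by
      linarith [min_le_right (n + 1 : ℝ) (φ n x), hφu n x, huw x, hfrac n x])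
  refine ⟨v, fun n => ?_, fun n x => le_max_left _ _, hvw, fun n => ⟨n + 1, fun x => ?_⟩,
    fun n => ⟨{x | (1 + ‖x‖) / (n + 1) ≤ min (n + 1 : ℝ) (φ n x)}, ?_, fun x hx => ?_,
      fun x hx => ?_⟩, fun x hx => ?_⟩
  · have := hφc n
    fun_prop
  · rw [abs_of_nonneg (le_max_left _ _)]
    exact max_le (hn n).le (by linarith [min_le_left (n + 1 : ℝ) (φ n x), hfrac n x])
  · refine Metric.isCompact_of_isClosed_isBounded ?_ ?_
    · have := hφc n
      exact isClosed_le (by fun_prop) (by fun_prop)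
    · refine (Metric.isBounded_closedBall (x := (0 : E)) (r := (n + 1) * (n + 1))).subset ?_
      intro x hx
      have h0 : (1 + ‖x‖) / (n + 1) ≤ min (n + 1 : ℝ) (φ n x) := hx
      have h1 := (div_le_iff₀ (hn n)).1 (h0.trans (min_le_left _ _))
      rw [mem_closedBall_zero_iff]
      linarith
  · by_contra hxU
    have h1 : (1 + ‖x‖) / (n + 1) ≤ min (n + 1 : ℝ) (φ n x) := hx
    have h2 : u x = 0 := indicator_of_notMem hxU _
    linarith [min_le_right (n + 1 : ℝ) (φ n x), hφu n x, hfrac n x]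
  · exact max_eq_left (by
      have : ¬ (1 + ‖x‖) / (n + 1) ≤ min (n + 1 : ℝ) (φ n x) := hx
      linarith [not_le.1 this])
  · refine tendsto_order.2 ⟨fun r hr => ?_, fun r hr => Eventually.of_forall fun n =>
      (hvw n x).trans_lt hr⟩
    obtain ⟨s, hrs, hsw⟩ := exists_between hr
    have hnear : ∀ᶠ y in 𝓝 x, s < u y := by
      filter_upwards [hw x s hsw, hU.mem_nhds hx] with y hy hyU
      rwa [hu, indicator_of_mem hyU]
    obtain ⟨δ, hδ, hball⟩ := Metric.eventually_nhds_iff.1 hnear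
    have hnat : Tendsto (fun n : ℕ => (n : ℝ)) atTop atTop := tendsto_natCast_atTop_atTop
    have hsmall : Tendsto (fun n : ℕ => (1 + ‖x‖) / ((n : ℝ) + 1)) atTop (𝓝 0) :=
      tendsto_const_nhds.div_atTop (tendsto_atTop_add_const_right _ _ hnat)
    filter_upwards [hnat.eventually_ge_atTop (s / δ), hnat.eventually_ge_atTop s,
      hsmall.eventually_lt_const (sub_pos.2 hrs)] with n h1 h2 h3
    have h4 : s ≤ φ n x := le_ciInf fun y => by
      by_cases hy : dist y x < δ
      · have := hball hy
        have h0 : 0 ≤ (n : ℝ) * dist x y := by positivity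
        linarith
      · have h5 : s ≤ n * δ := (div_le_iff₀ hδ).1 h1
        have h6 : (n : ℝ) * δ ≤ n * dist x y := by
          rw [dist_comm]
          gcongr
          exact not_lt.1 hy
        linarith [hu0 y]
    have h7 : s ≤ min (n + 1 : ℝ) (φ n x) := le_min (by linarith) h4
    exact lt_of_lt_of_le (by linarith) (le_max_right _ _)

namespace IsApproximable

variable {𝒜 : Type*} [MetricSpace 𝒜] [MeasurableSpace 𝒜]
  {M : MDPTuple (EuclideanSpace ℝ (Fin m)) 𝒜} {D : ApproxData m}

/-! ### The transition law and the feasible controls -/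

theorem ψ_eq (hM : IsApproximable M D) (t : ℕ) : M.ψ t = M.ψ 0 :=
  hM.isMDP.stationary t 0

theorem restrict_S (hM : IsApproximable M D) {t : ℕ} {p : EuclideanSpace ℝ (Fin m) × 𝒜}
    (hp : p ∈ M.K t) : (M.Q t p.1 p.2).restrict (M.S (t + 1)) = M.Q t p.1 p.2 :=
  Measure.restrict_eq_self_of_ae_mem (hM.isMDP.Q_support t p hp)

theorem ae_mem_S (hM : IsApproximable M D) {t : ℕ} {p : EuclideanSpace ℝ (Fin m) × 𝒜}
    (hp : p ∈ M.K t) : ∀ᵐ y ∂(M.Q t p.1 p.2), y ∈ M.S (t + 1) :=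
  hM.isMDP.Q_support t p hp

theorem zeta_eq (hM : IsApproximable M D) {t : ℕ} {p : EuclideanSpace ℝ (Fin m) × 𝒜}
    (hp : p ∈ M.K t) (v : EuclideanSpace ℝ (Fin m) → ℝ) :
    M.zeta v t p = ∫ y, v y ∂(M.Q t p.1 p.2) := by
  rw [MDPTuple.zeta, hM.restrict_S hp]

theorem integrable_of_abs_le (hM : IsApproximable M D) {t : ℕ}
    {p : EuclideanSpace ℝ (Fin m) × 𝒜} (hp : p ∈ M.K t) {v : EuclideanSpace ℝ (Fin m) → ℝ} {C : ℝ}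
    (hv : AEStronglyMeasurable v ((M.Q t p.1 p.2).restrict (M.S (t + 1))))
    (hC : ∀ y ∈ M.S (t + 1), |v y| ≤ C * D.w y) : Integrable v (M.Q t p.1 p.2) := by
  rw [hM.restrict_S hp] at hv
  exact ((hM.w_integrable t p hp).const_mul C).mono' hv
    ((hM.ae_mem_S hp).mono fun y hy => hC y hy)

theorem abs_zeta_le (hM : IsApproximable M D) {dbar : ℝ}
    (hd : ∀ t, ∀ p ∈ M.K t, M.zeta D.w t p ≤ dbar * D.w p.1) {t : ℕ}
    {p : EuclideanSpace ℝ (Fin m) × 𝒜} (hp : p ∈ M.K t) {v : EuclideanSpace ℝ (Fin m) → ℝ} {C : ℝ}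
    (hC0 : 0 ≤ C) (hC : ∀ y ∈ M.S (t + 1), |v y| ≤ C * D.w y) :
    |M.zeta v t p| ≤ C * dbar * D.w p.1 := by
  have h1 := hd t p hp
  rw [hM.zeta_eq hp] at h1 ⊢
  calc |∫ y, v y ∂(M.Q t p.1 p.2)| ≤ ∫ y, C * D.w y ∂(M.Q t p.1 p.2) :=
        norm_integral_le_of_norm_le (f := v) ((hM.w_integrable t p hp).const_mul C)
          ((hM.ae_mem_S hp).mono fun y hy => hC y hy)
    _ = C * ∫ y, D.w y ∂(M.Q t p.1 p.2) := integral_const_mul _ _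
    _ ≤ C * (dbar * D.w p.1) := mul_le_mul_of_nonneg_left h1 hC0
    _ = _ := by ring

theorem exists_mem_ψ_dist_le (hM : IsApproximable M D) {Lψ : ℝ}
    (hL : ∀ t x y, Metric.hausdorffDist (M.ψ t x) (M.ψ t y) ≤ Lψ * dist x y) (t : ℕ)
    {x : EuclideanSpace ℝ (Fin m)} (y : EuclideanSpace ℝ (Fin m)) {a : 𝒜} (ha : a ∈ M.ψ t x) :
    ∃ a' ∈ M.ψ t y, dist a a' ≤ Lψ * dist x y := by
  obtain ⟨a', ha', h⟩ :=
    (hM.ψ_compact t y).exists_infDist_eq_dist (hM.isMDP.ψ_nonempty t y) a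
  refine ⟨a', ha', ?_⟩
  rw [← h]
  exact (Metric.infDist_le_hausdorffDist_of_mem ha
    (Metric.hausdorffEDist_ne_top_of_nonempty_of_bounded (hM.isMDP.ψ_nonempty t x)
      (hM.isMDP.ψ_nonempty t y) (hM.ψ_compact t x).isBounded
      (hM.ψ_compact t y).isBounded)).trans (hL t x y)

/-! ### Compact families -/

/-- The graph of the control correspondence over a compact set is compact. -/
theorem isCompact_graph (hM : IsApproximable M D) (t : ℕ) {H : Set (EuclideanSpace ℝ (Fin m))}
    (hH : IsCompact H) :
    IsCompact {p : EuclideanSpace ℝ (Fin m) × 𝒜 | p.1 ∈ H ∧ p.2 ∈ M.ψ t p.1} := by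
  obtain ⟨Lψ, -, hL⟩ := hM.ψ_lipschitz
  refine IsSeqCompact.isCompact fun p hp => ?_
  obtain ⟨x, hx, φ, hφ, hlim⟩ := hH.tendsto_subseq fun n => (hp n).1
  -- move the controls into the compact set `ψ(x)`, at a cost that tends to zero
  choose a ha hda using fun n => hM.exists_mem_ψ_dist_le hL t x (hp (φ n)).2
  obtain ⟨a₀, ha₀, χ, hχ, hlim'⟩ := (hM.ψ_compact t x).tendsto_subseq ha
  refine ⟨(x, a₀), ⟨hx, ha₀⟩, φ ∘ χ, hφ.comp hχ, ?_⟩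
  have hx' : Tendsto (fun n => (p (φ (χ n))).1) atTop (𝓝 x) := hlim.comp hχ.tendsto_atTop
  refine Tendsto.prodMk_nhds hx' ?_
  have hz : Tendsto (fun n => Lψ * dist (p (φ (χ n))).1 x) atTop (𝓝 0) := by
    simpa using (tendsto_iff_dist_tendsto_zero.1 hx').const_mul Lψ
  have hd : Tendsto (fun n => dist (a (χ n)) (p (φ (χ n))).2) atTop (𝓝 0) :=
    squeeze_zero (fun _ => dist_nonneg)
      (fun n => (dist_comm _ _).trans_le (hda (χ n))) hz
  exact hlim'.congr_dist hd

/-- Uniform tightness: over a compact set of states and controls the `w`-weighted transition laws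
are, up to `α`, carried by one compact subset of the next state space. Near a given point the
compact set is the support of a continuous `v ≤ w` whose integral is close to that of `w`, because
`ζ_w - ζ_v` is upper semicontinuous. -/
theorem exists_isCompact_setIntegral_compl_le (hM : IsApproximable M D) (t : ℕ) {α : ℝ}
    (hα : 0 < α) {G : Set (EuclideanSpace ℝ (Fin m) × 𝒜)} (hG : IsCompact G) (hGK : G ⊆ M.K t) :
    ∃ C : Set (EuclideanSpace ℝ (Fin m)), IsCompact C ∧ C ⊆ M.S (t + 1) ∧
      ∀ p ∈ G, ∫ y in Cᶜ, D.w y ∂(M.Q t p.1 p.2) ≤ α := by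
  have hwn : ∀ (μ : Measure (EuclideanSpace ℝ (Fin m))), 0 ≤ᵐ[μ] D.w := fun μ =>
    Eventually.of_forall fun y => (hM.w_pos y).le
  have mono : ∀ {C C' : Set (EuclideanSpace ℝ (Fin m))} {p}, p ∈ M.K t → C ⊆ C' →
      ∫ y in C'ᶜ, D.w y ∂(M.Q t p.1 p.2) ≤ ∫ y in Cᶜ, D.w y ∂(M.Q t p.1 p.2) :=
    fun hp h => setIntegral_mono_set (hM.w_integrable t _ hp).integrableOn (hwn _)
      (LE.le.eventuallyLE (compl_subset_compl.2 h))
  -- membership in `𝕂_t` moves into the conclusion, as the induction ranges over arbitrary sets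
  suffices h : ∃ C : Set (EuclideanSpace ℝ (Fin m)), IsCompact C ∧ C ⊆ M.S (t + 1) ∧
      ∀ p ∈ G, p ∈ M.K t → ∫ y in Cᶜ, D.w y ∂(M.Q t p.1 p.2) ≤ α by
    obtain ⟨C, h1, h2, h3⟩ := h
    exact ⟨C, h1, h2, fun p hp => h3 p hp (hGK hp)⟩
  refine hG.induction_on (p := fun G => ∃ C : Set (EuclideanSpace ℝ (Fin m)), IsCompact C ∧
    C ⊆ M.S (t + 1) ∧ ∀ p ∈ G, p ∈ M.K t → ∫ y in Cᶜ, D.w y ∂(M.Q t p.1 p.2) ≤ α)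
    ⟨∅, isCompact_empty, empty_subset _, fun _ hp => hp.elim⟩ ?_ ?_ fun p hp => ?_
  · rintro s s' hss ⟨C, h1, h2, h3⟩
    exact ⟨C, h1, h2, fun p hp => h3 p (hss hp)⟩
  · rintro s s' ⟨C, h1, h2, h3⟩ ⟨C', h1', h2', h3'⟩
    refine ⟨C ∪ C', h1.union h1', union_subset h2 h2', fun p hp hpK => ?_⟩
    rcases hp with hp | hp
    · exact (mono hpK subset_union_left).trans (h3 p hp hpK)
    · exact (mono hpK subset_union_right).trans (h3' p hp hpK)
  · have hpK := hGK hp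
    have := hM.isMDP.S_locallyCompact (t + 1)
    obtain ⟨U, hUo, hSU, hUS⟩ := exists_isOpen_inter_closure_subset (M.S (t + 1))
    obtain ⟨v, hvc, hv0, hvw, hvb, hvC, hvlim⟩ :=
      exists_seq_continuous_tendsto_of_lowerSemicontinuous hUo hM.w_lsc hM.w_pos
    have hint : ∀ n q, q ∈ M.K t → Integrable (v n) (M.Q t q.1 q.2) := fun n q hq =>
      (hM.w_integrable t q hq).mono' (hvc n).aestronglyMeasurable
        (Eventually.of_forall fun y => by
          rw [Real.norm_eq_abs, abs_of_nonneg (hv0 n y)]; exact hvw n y)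
    have hlim : Tendsto (fun n => M.zeta (v n) t p) atTop (𝓝 (M.zeta D.w t p)) := by
      simp only [hM.zeta_eq hpK]
      refine tendsto_integral_of_dominated_convergence D.w
        (fun n => (hvc n).aestronglyMeasurable) (hM.w_integrable t p hpK)
        (fun n => Eventually.of_forall fun y => ?_)
        ((hM.ae_mem_S hpK).mono fun y hy => hvlim y (hSU hy))
      rw [Real.norm_eq_abs, abs_of_nonneg (hv0 n y)]
      exact hvw n y
    obtain ⟨n, hn⟩ := (hlim.eventually_const_lt
      (show M.zeta D.w t p - α / 2 < M.zeta D.w t p by linarith)).exists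
    obtain ⟨C, hC, hCU, hCv⟩ := hvC n
    have h1 : ∀ᶠ q in 𝓝[M.K t] p, M.zeta D.w t q < M.zeta (v n) t p + α / 2 :=
      hM.zeta_w_usc t p hpK _ (by linarith)
    have h2 : ∀ᶠ q in 𝓝[M.K t] p, M.zeta (v n) t p - α / 2 < M.zeta (v n) t q :=
      (hM.feller (v n) (hvc n) (hvb n) t p hpK).eventually_const_lt (by linarith)
    refine ⟨{q | M.zeta D.w t q < M.zeta (v n) t p + α / 2 ∧
      M.zeta (v n) t p - α / 2 < M.zeta (v n) t q},
      nhdsWithin_mono p hGK (h1.and h2), C ∩ closure (M.S (t + 1)),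
      hC.inter_right isClosed_closure, fun y hy => hUS ⟨hCU hy.1, hy.2⟩, fun q hq hqK => ?_⟩
    obtain ⟨hq1, hq2⟩ := hq
    have hmeas : MeasurableSet (C ∩ closure (M.S (t + 1)))ᶜ :=
      (hC.inter_right isClosed_closure).measurableSet.compl
    calc ∫ y in (C ∩ closure (M.S (t + 1)))ᶜ, D.w y ∂(M.Q t q.1 q.2)
        = ∫ y in (C ∩ closure (M.S (t + 1)))ᶜ, (D.w y - v n y) ∂(M.Q t q.1 q.2) := by
          refine setIntegral_congr_ae hmeas ((hM.ae_mem_S hqK).mono fun y hy hyC => ?_)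
          rw [hCv y fun h => hyC ⟨h, subset_closure hy⟩, sub_zero]
      _ ≤ ∫ y, (D.w y - v n y) ∂(M.Q t q.1 q.2) :=
          setIntegral_le_integral ((hM.w_integrable t q hqK).sub (hint n q hqK))
            (Eventually.of_forall fun y => sub_nonneg.2 (hvw n y))
      _ = M.zeta D.w t q - M.zeta (v n) t q := by
          rw [integral_sub (hM.w_integrable t q hqK) (hint n q hqK), hM.zeta_eq hqK,
            hM.zeta_eq hqK]
      _ ≤ α := by linarith

/-- The sets are built forward in time; adding a point of `X_{t+1}` keeps them non-empty. -/
theorem exists_mem_compactFamilies (hM : IsApproximable M D) {α : ℝ} (hα : 0 < α) :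
    ∃ H, H ∈ compactFamilies M D.w α := by
  have step : ∀ (t : ℕ) (H : Set (EuclideanSpace ℝ (Fin m))), ∃ C,
      IsCompact H → H ⊆ M.S t → C.Nonempty ∧ IsCompact C ∧ C ⊆ M.S (t + 1) ∧
        ∀ x ∈ H, ∀ a ∈ M.ψ t x, ∫ y in Cᶜ, D.w y ∂(M.Q t x a) ≤ α := by
    intro t H
    by_cases hH : IsCompact H ∧ H ⊆ M.S t
    · have hGK : {p : EuclideanSpace ℝ (Fin m) × 𝒜 | p.1 ∈ H ∧ p.2 ∈ M.ψ t p.1} ⊆ M.K t :=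
        fun p hp => ⟨hH.2 hp.1, hp.2⟩
      obtain ⟨C, hC, hCS, h⟩ :=
        hM.exists_isCompact_setIntegral_compl_le t hα (hM.isCompact_graph t hH.1) hGK
      obtain ⟨z, hz⟩ := hM.isMDP.S_nonempty (t + 1)
      refine ⟨insert z C, fun _ _ => ⟨insert_nonempty _ _, hC.insert z,
        insert_subset hz hCS, fun x hx a ha => le_trans ?_ (h (x, a) ⟨hx, ha⟩)⟩⟩
      exact setIntegral_mono_set (hM.w_integrable t (x, a) (hGK ⟨hx, ha⟩)).integrableOn
        (Eventually.of_forall fun y => (hM.w_pos y).le)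
        (LE.le.eventuallyLE (compl_subset_compl.2 (subset_insert z C)))
    · exact ⟨∅, fun h1 h2 => (hH ⟨h1, h2⟩).elim⟩
  choose next hnext using step
  obtain ⟨z, hz⟩ := hM.isMDP.S_nonempty 0
  let H : ℕ → Set (EuclideanSpace ℝ (Fin m)) := fun t => Nat.rec {z} next t
  have hH : ∀ t, (H t).Nonempty ∧ IsCompact (H t) ∧ H t ⊆ M.S t := by
    intro t
    induction t with
    | zero => exact ⟨singleton_nonempty z, isCompact_singleton, singleton_subset_iff.2 hz⟩
    | succ t ih =>
      obtain ⟨h1, h2, h3, -⟩ := hnext t (H t) ih.2.1 ih.2.2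
      exact ⟨h1, h2, h3⟩
  exact ⟨H, fun t _ => hH t, fun t _ => (hnext t (H t) (hH t).2.1 (hH t).2.2).2.2.2⟩

end IsApproximable

/-! ### The Bellman operator -/

/-- The Bellman operator at time `t`, which takes `J_{t+1}` to `J_t`. It does not involve the
terminal cost, so that it is common to a process and its smoothings. -/
noncomputable def bellman {X 𝒜 : Type*} [MeasurableSpace X] (M : MDPTuple X 𝒜) (t : ℕ)
    (v : X → ℝ) (x : X) : ℝ :=
  ⨅ a : M.ψ t x, (M.c x a + M.zeta v t (x, a))

theorem J_eq_bellman {X 𝒜 : Type*} [MeasurableSpace X] (M : MDPTuple X 𝒜) {t : ℕ}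
    (ht : t < M.T) : M.J t = bellman M t (M.J (t + 1)) :=
  funext fun x => M.J_bellman ht x

theorem J_Phi₁_eq_bellman {𝒜 : Type*} (M : MDPTuple (EuclideanSpace ℝ (Fin m)) 𝒜)
    (D : ApproxData m) (lam : ℝ) {t : ℕ} (ht : t < M.T) :
    (Phi₁ M D lam).J t = bellman M t ((Phi₁ M D lam).J (t + 1)) :=
  J_eq_bellman (Phi₁ M D lam) ht

theorem J_Phi₁_terminal {𝒜 : Type*} (M : MDPTuple (EuclideanSpace ℝ (Fin m)) 𝒜)
    (D : ApproxData m) (lam : ℝ) :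
    (Phi₁ M D lam).J M.T = fun x => D.h₁ x + D.hTilde lam x :=
  (Phi₁ M D lam).J_terminal

namespace IsApproximable

variable {𝒜 : Type*} [MetricSpace 𝒜] [MeasurableSpace 𝒜]
  {M : MDPTuple (EuclideanSpace ℝ (Fin m)) 𝒜} {D : ApproxData m}

/-- The costs over which the Bellman operator minimizes are bounded by a multiple of the weight,
uniformly in the control. -/
theorem exists_abs_cost_le (hM : IsApproximable M D) {t : ℕ} {v : EuclideanSpace ℝ (Fin m) → ℝ}
    (hv : ∃ C, ∀ y ∈ M.S (t + 1), |v y| ≤ C * D.w y) :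
    ∃ C, ∀ x ∈ M.S t, ∀ a ∈ M.ψ t x, |M.c x a + M.zeta v t (x, a)| ≤ C * D.w x := by
  obtain ⟨C₀, -, hc, -⟩ := hM.exists_abs_terminal_le
  obtain ⟨dbar, -, hd⟩ := hM.zeta_w_le
  obtain ⟨C, hC⟩ := hv
  refine ⟨C₀ + |C| * dbar, fun x hx a ha => ?_⟩
  have h1 := hM.abs_zeta_le hd (p := (x, a)) ⟨hx, ha⟩ (abs_nonneg C) fun y hy =>
    (hC y hy).trans (mul_le_mul_of_nonneg_right (le_abs_self C) (hM.w_pos y).le)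
  have h2 := hc x a (hM.ψ_eq t ▸ ha)
  have h3 := abs_add_le (M.c x a) (M.zeta v t (x, a))
  linarith

/-- The infimum in the Bellman operator is a genuine one. -/
theorem bddBelow_cost (hM : IsApproximable M D) {t : ℕ} {v : EuclideanSpace ℝ (Fin m) → ℝ}
    (hv : ∃ C, ∀ y ∈ M.S (t + 1), |v y| ≤ C * D.w y) {x : EuclideanSpace ℝ (Fin m)}
    (hx : x ∈ M.S t) :
    BddBelow (range fun a : M.ψ t x => M.c x a + M.zeta v t (x, a)) := by
  obtain ⟨C, hC⟩ := hM.exists_abs_cost_le hv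
  refine ⟨-(C * D.w x), ?_⟩
  rintro _ ⟨a, rfl⟩
  exact (abs_le.1 (hC x hx a a.2)).1

theorem nonempty_ψ (hM : IsApproximable M D) (t : ℕ) (x : EuclideanSpace ℝ (Fin m)) :
    Nonempty (M.ψ t x) :=
  (hM.isMDP.ψ_nonempty t x).to_subtype

theorem exists_abs_bellman_le (hM : IsApproximable M D) {t : ℕ}
    {v : EuclideanSpace ℝ (Fin m) → ℝ} (hv : ∃ C, ∀ y ∈ M.S (t + 1), |v y| ≤ C * D.w y) :
    ∃ C, ∀ x ∈ M.S t, |bellman M t v x| ≤ C * D.w x := by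
  obtain ⟨C, hC⟩ := hM.exists_abs_cost_le hv
  refine ⟨C, fun x hx => ?_⟩
  have := hM.nonempty_ψ t x
  have hb := hM.bddBelow_cost hv hx
  obtain ⟨a₀⟩ := hM.nonempty_ψ t x
  exact abs_le.2 ⟨le_ciInf fun a => (abs_le.1 (hC x hx a a.2)).1,
    (ciInf_le hb a₀).trans (abs_le.1 (hC x hx a₀ a₀.2)).2⟩

/-- The integrals of a Lipschitz function on `X_{t+1}` are Lipschitz in the state and the
control. -/
theorem abs_zeta_sub_zeta_le (hM : IsApproximable M D) {t : ℕ}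
    {v : EuclideanSpace ℝ (Fin m) → ℝ} (hv : ∃ C, ∀ y ∈ M.S (t + 1), |v y| ≤ C * D.w y) {L : ℝ≥0}
    (hL : LipschitzOnWith L v (M.S (t + 1))) {p q : EuclideanSpace ℝ (Fin m) × 𝒜}
    (hp : p ∈ M.K t) (hq : q ∈ M.K t) :
    |M.zeta v t p - M.zeta v t q| ≤ D.Lq * L * (dist p.1 q.1 + dist p.2 q.2) := by
  -- the hypothesis on the transition law is about functions on the whole space
  obtain ⟨g, hg, hvg⟩ := hL.extend_real
  obtain ⟨C, hC⟩ := hv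
  have hz : ∀ r, M.zeta v t r = M.zeta g t r := fun r =>
    setIntegral_congr_fun (hM.isMDP.S_measurable (t + 1)) hvg
  have hi : ∀ r ∈ M.K t, Integrable g (M.Q t r.1 r.2) := fun r hr =>
    hM.integrable_of_abs_le hr hg.continuous.aestronglyMeasurable fun y hy => by
      rw [← hvg hy]; exact hC y hy
  rw [hz, hz]
  exact hM.zeta_lipschitz t p hp q hq g L hg (hi p hp) (hi q hq)

/-- A control feasible in `x` is within `L_ψ d(x, y)` of one feasible in `y`, so that minimizing
multiplies the Lipschitz constant of the cost by at most `1 + L_ψ`. -/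
theorem exists_lipschitzOnWith_bellman (hM : IsApproximable M D) {t : ℕ}
    {v : EuclideanSpace ℝ (Fin m) → ℝ} (hv : ∃ C, ∀ y ∈ M.S (t + 1), |v y| ≤ C * D.w y)
    (hL : ∃ L : ℝ≥0, LipschitzOnWith L v (M.S (t + 1))) :
    ∃ L : ℝ≥0, LipschitzOnWith L (bellman M t v) (M.S t) := by
  obtain ⟨L, hL⟩ := hL
  obtain ⟨Lc, hLc⟩ := hM.c_lipschitz
  obtain ⟨Lψ, hψ0, hψ⟩ := hM.ψ_lipschitz
  have hq := hM.Lq_pos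
  set A : ℝ := (Lc + D.Lq * L) * (1 + Lψ) with hA
  have hA0 : 0 ≤ A := by positivity
  have key : ∀ x ∈ M.S t, ∀ y ∈ M.S t, ∀ a : M.ψ t x, ∃ a' : M.ψ t y,
      M.c y a' + M.zeta v t (y, a') ≤ M.c x a + M.zeta v t (x, a) + A * dist x y := by
    intro x hx y hy a
    obtain ⟨a', ha', hd⟩ := hM.exists_mem_ψ_dist_le hψ t y a.2
    refine ⟨⟨a', ha'⟩, ?_⟩
    have h1 := hM.abs_zeta_sub_zeta_le hv hL (p := (x, a)) (q := (y, a')) ⟨hx, a.2⟩ ⟨hy, ha'⟩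
    have h2 := hLc (x, a) (hM.ψ_eq t ▸ a.2 : (a : 𝒜) ∈ M.ψ 0 x) (y, a')
      (hM.ψ_eq t ▸ ha' : a' ∈ M.ψ 0 y)
    have h3 : (Lc + D.Lq * L) * (dist x y + dist (a : 𝒜) a') ≤ A * dist x y := by
      rw [hA, mul_assoc]
      refine mul_le_mul_of_nonneg_left ?_ (by positivity)
      linarith
    have h4 := (abs_le.1 h1).1
    have h5 := (abs_le.1 h2).1
    simp only at h4 h5 ⊢
    linarith
  refine ⟨A.toNNReal, LipschitzOnWith.of_dist_le_mul fun x hx y hy => ?_⟩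
  rw [Real.dist_eq, Real.coe_toNNReal A hA0]
  have := hM.nonempty_ψ t x
  have := hM.nonempty_ψ t y
  refine abs_iInf_sub_iInf_le (hM.bddBelow_cost hv hx) (hM.bddBelow_cost hv hy)
    (key x hx y hy) ?_
  rw [dist_comm]
  exact key y hy x hx

theorem abs_bellman_sub_bellman_le (hM : IsApproximable M D) {t : ℕ}
    {v v' : EuclideanSpace ℝ (Fin m) → ℝ} (hv : ∃ C, ∀ y ∈ M.S (t + 1), |v y| ≤ C * D.w y)
    (hv' : ∃ C, ∀ y ∈ M.S (t + 1), |v' y| ≤ C * D.w y) {x : EuclideanSpace ℝ (Fin m)}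
    (hx : x ∈ M.S t) {ε : ℝ} (h : ∀ a ∈ M.ψ t x, |M.zeta v t (x, a) - M.zeta v' t (x, a)| ≤ ε) :
    |bellman M t v x - bellman M t v' x| ≤ ε := by
  have := hM.nonempty_ψ t x
  exact abs_iInf_sub_iInf_le (hM.bddBelow_cost hv hx) (hM.bddBelow_cost hv' hx)
    (fun a => ⟨a, by linarith [(abs_le.1 (h a a.2)).1]⟩)
    fun a => ⟨a, by linarith [(abs_le.1 (h a a.2)).2]⟩

/-! ### Regularity of the cost-to-go functions -/

/-- Any solution of the Bellman recursion inherits the weighted bound of its terminal value; this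
serves both the process and its smoothings. -/
theorem exists_abs_le_of_recursion (hM : IsApproximable M D)
    {V : ℕ → EuclideanSpace ℝ (Fin m) → ℝ} (hV : ∀ t < M.T, V t = bellman M t (V (t + 1)))
    (hT : ∃ C, ∀ x, |V M.T x| ≤ C * D.w x) {t : ℕ} (ht : t ≤ M.T) :
    ∃ C, ∀ x ∈ M.S t, |V t x| ≤ C * D.w x := by
  induction ht using Nat.decreasingInduction with
  | self => exact hT.imp fun C h x _ => h x
  | of_succ t ht ih =>
    rw [hV t ht]
    exact hM.exists_abs_bellman_le ih

theorem exists_abs_J_le (hM : IsApproximable M D) {t : ℕ} (ht : t ≤ M.T) :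
    ∃ C, ∀ x ∈ M.S t, |M.J t x| ≤ C * D.w x := by
  obtain ⟨C, -, -, h, -⟩ := hM.exists_abs_terminal_le
  exact hM.exists_abs_le_of_recursion (fun t ht => J_eq_bellman M ht)
    ⟨C, by rwa [MDPTuple.J_terminal]⟩ ht

theorem exists_abs_J_Phi₁_le (hM : IsApproximable M D) (lam : ℝ) {t : ℕ} (ht : t ≤ M.T) :
    ∃ C, ∀ x ∈ M.S t, |(Phi₁ M D lam).J t x| ≤ C * D.w x := by
  obtain ⟨C, -, -, -, h⟩ := hM.exists_abs_terminal_le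
  exact hM.exists_abs_le_of_recursion (fun t ht => J_Phi₁_eq_bellman M D lam ht)
    ⟨C, by rw [J_Phi₁_terminal]; exact h lam⟩ ht

theorem finiteWNorm_J (hM : IsApproximable M D) {t : ℕ} (ht : t ≤ M.T) :
    FiniteWNorm (M.S t) D.w (M.J t) :=
  let ⟨_, h⟩ := hM.exists_abs_J_le ht
  finiteWNorm_of_le hM.w_pos h

theorem finiteWNorm_J_Phi₁ (hM : IsApproximable M D) (lam : ℝ) {t : ℕ} (ht : t ≤ M.T) :
    FiniteWNorm (M.S t) D.w ((Phi₁ M D lam).J t) :=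
  let ⟨_, h⟩ := hM.exists_abs_J_Phi₁_le lam ht
  finiteWNorm_of_le hM.w_pos h

theorem exists_lipschitzOnWith_J_Phi₁ (hM : IsApproximable M D) (lam : ℝ) {t : ℕ}
    (ht : t ≤ M.T) : ∃ L : ℝ≥0, LipschitzOnWith L ((Phi₁ M D lam).J t) (M.S t) := by
  induction ht using Nat.decreasingInduction with
  | self =>
    obtain ⟨L₁, h₁⟩ := hM.h₁_lipschitz
    obtain ⟨L₂, h₂⟩ := hM.exists_lipschitzWith_hTilde lam
    rw [J_Phi₁_terminal]
    exact ⟨L₁ + L₂, (h₁.add h₂).lipschitzOnWith⟩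
  | of_succ t ht ih =>
    rw [J_Phi₁_eq_bellman M D lam ht]
    exact hM.exists_lipschitzOnWith_bellman (hM.exists_abs_J_Phi₁_le lam ht) ih

theorem integrable_J_Phi₁ (hM : IsApproximable M D) (lam : ℝ) {t : ℕ} (ht : t < M.T)
    {p : EuclideanSpace ℝ (Fin m) × 𝒜} (hp : p ∈ M.K t) :
    Integrable ((Phi₁ M D lam).J (t + 1)) (M.Q t p.1 p.2) := by
  obtain ⟨C, hC⟩ := hM.exists_abs_J_Phi₁_le lam ht
  obtain ⟨L, hL⟩ := hM.exists_lipschitzOnWith_J_Phi₁ lam ht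
  exact hM.integrable_of_abs_le hp
    (hL.continuousOn.aestronglyMeasurable (hM.isMDP.S_measurable (t + 1))) hC

/-! ### The error of smoothing -/

/-- The last step before the horizon, where the terminal costs differ only in the region of
smoothing. -/
theorem abs_zeta_J_sub_zeta_J_Phi₁_le (hM : IsApproximable M D) {t : ℕ} (ht : t + 1 = M.T)
    {lam θ : ℝ} {p : EuclideanSpace ℝ (Fin m) × 𝒜} (hp : p ∈ M.K t)
    (hR : ∫ y in D.region lam, D.w y ∂(M.Q t p.1 p.2) ≤ θ) :
    |M.zeta (M.J (t + 1)) t p - M.zeta ((Phi₁ M D lam).J (t + 1)) t p| ≤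
      θ * (wNorm (M.S M.T) D.w (M.J M.T) + wNorm (M.S M.T) D.w ((Phi₁ M D lam).J M.T)) := by
  set B := wNorm (M.S M.T) D.w (M.J M.T) + wNorm (M.S M.T) D.w ((Phi₁ M D lam).J M.T) with hB
  have hB0 : 0 ≤ B := add_nonneg (wNorm_nonneg hM.w_pos) (wNorm_nonneg hM.w_pos)
  have hJ : Integrable (M.J (t + 1)) (M.Q t p.1 p.2) := by
    obtain ⟨C, hC⟩ := hM.exists_abs_J_le ht.le
    refine hM.integrable_of_abs_le hp ?_ hC
    rw [ht, MDPTuple.J_terminal]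
    exact hM.isMDP.h_measurable.aestronglyMeasurable
  have hJ' := hM.integrable_J_Phi₁ lam (t := t) (by omega) hp
  have hmeas := hM.measurableSet_region lam
  rw [hM.zeta_eq hp, hM.zeta_eq hp, ← integral_sub hJ hJ']
  calc |∫ y, (M.J (t + 1) y - (Phi₁ M D lam).J (t + 1) y) ∂(M.Q t p.1 p.2)|
      ≤ ∫ y, (D.region lam).indicator (fun y => B * D.w y) y ∂(M.Q t p.1 p.2) := by
        refine norm_integral_le_of_norm_le
          (f := fun y => M.J (t + 1) y - (Phi₁ M D lam).J (t + 1) y)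
          (((hM.w_integrable t p hp).const_mul B).indicator hmeas)
          ((hM.ae_mem_S hp).mono fun y hy => ?_)
        rw [ht] at hy ⊢
        by_cases hyR : y ∈ D.region lam
        · rw [indicator_of_mem hyR, Real.norm_eq_abs, hB, add_mul]
          exact (abs_sub _ _).trans (add_le_add
            ((hM.finiteWNorm_J le_rfl).abs_le hM.w_pos hy)
            ((hM.finiteWNorm_J_Phi₁ lam le_rfl).abs_le hM.w_pos hy))
        · rw [indicator_of_notMem hyR, MDPTuple.J_terminal, J_Phi₁_terminal,
            hM.h_eq_of_notMem_region hyR]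
          simp
    _ = B * ∫ y in D.region lam, D.w y ∂(M.Q t p.1 p.2) := by
        rw [integral_indicator hmeas, integral_const_mul]
    _ ≤ B * θ := mul_le_mul_of_nonneg_left hR hB0
    _ = θ * B := mul_comm _ _

/-- Smoothing the terminal cost changes the earlier cost-to-go functions by at most `θ` times the
norms of the terminal costs. The induction needs `J_{t+1}` to be measurable on `X_{t+1}`, which
holds since `J_{t+1}` is, by the inductive hypothesis for all `θ`, a limit of Lipschitz functions
there. -/
theorem abs_J_sub_J_Phi₁_le (hM : IsApproximable M D) {t : ℕ} (ht : t < M.T) {lam θ : ℝ}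
    (hR : ∀ s, s + 1 = M.T → ∀ p ∈ M.K s, ∫ y in D.region lam, D.w y ∂(M.Q s p.1 p.2) ≤ θ)
    {x : EuclideanSpace ℝ (Fin m)} (hx : x ∈ M.S t) :
    |M.J t x - (Phi₁ M D lam).J t x| ≤
      θ * (wNorm (M.S M.T) D.w (M.J M.T) + wNorm (M.S M.T) D.w ((Phi₁ M D lam).J M.T)) := by
  obtain ⟨k, hk⟩ : ∃ k, t + 1 + k = M.T := ⟨M.T - (t + 1), by omega⟩
  induction k generalizing t lam θ x with
  | zero =>
    rw [J_eq_bellman M ht, J_Phi₁_eq_bellman M D lam ht]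
    exact hM.abs_bellman_sub_bellman_le (hM.exists_abs_J_le ht) (hM.exists_abs_J_Phi₁_le lam ht)
      hx fun a ha => hM.abs_zeta_J_sub_zeta_J_Phi₁_le hk ⟨hx, ha⟩ (hR t hk (x, a) ⟨hx, ha⟩)
  | succ k ih =>
    have ht1 : t + 1 < M.T := by omega
    have hmeas : ∀ μ : Measure (EuclideanSpace ℝ (Fin m)),
        AEStronglyMeasurable (M.J (t + 1)) (μ.restrict (M.S (t + 1))) := by
      intro μ
      obtain ⟨C, hC, -, h1, h2⟩ := hM.exists_abs_terminal_le
      have hex : ∀ n : ℕ, ∃ l : ℝ, ∀ s, s + 1 = M.T → ∀ p ∈ M.K s,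
          ∫ y in D.region l, D.w y ∂(M.Q s p.1 p.2) ≤ 1 / ((n : ℝ) + 1) := fun n => by
        obtain ⟨Λ, -, hΛ⟩ := hM.region_small (1 / ((n : ℝ) + 1)) (by positivity)
        exact ⟨Λ + 1, fun s hs p hp => (hΛ _ (by linarith) s hs p hp).le⟩
      choose l hl using hex
      refine aestronglyMeasurable_of_tendsto_ae atTop
        (f := fun n => (Phi₁ M D (l n)).J (t + 1)) (fun n => ?_) ?_
      · obtain ⟨L, hL⟩ := hM.exists_lipschitzOnWith_J_Phi₁ (l n) ht
        exact hL.continuousOn.aestronglyMeasurable (hM.isMDP.S_measurable (t + 1))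
      · refine ae_restrict_of_forall_mem (hM.isMDP.S_measurable (t + 1)) fun y hy => ?_
        refine tendsto_iff_dist_tendsto_zero.2 (squeeze_zero (fun _ => dist_nonneg)
          (g := fun n : ℕ => 1 / ((n : ℝ) + 1) * (C + C)) (fun n => ?_) ?_)
        · rw [dist_comm, Real.dist_eq]
          refine (ih ht1 (hl n) hy (by omega)).trans ?_
          have e1 := wNorm_le hM.w_pos (hM.isMDP.S_nonempty M.T)
            (v := M.J M.T) (C := C) fun x _ => by rw [MDPTuple.J_terminal]; exact h1 x
          have e2 := wNorm_le hM.w_pos (hM.isMDP.S_nonempty M.T)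
            (v := (Phi₁ M D (l n)).J M.T) (C := C) fun x _ => by
              rw [J_Phi₁_terminal]; exact h2 (l n) x
          gcongr
        · simpa using tendsto_one_div_add_atTop_nhds_zero_nat.mul_const (C + C)
    rw [J_eq_bellman M ht, J_Phi₁_eq_bellman M D lam ht]
    refine hM.abs_bellman_sub_bellman_le (hM.exists_abs_J_le ht) (hM.exists_abs_J_Phi₁_le lam ht)
      hx fun a ha => ?_
    have hp : (x, a) ∈ M.K t := ⟨hx, ha⟩
    have := hM.isMDP.Q_probability t (x, a) hp
    obtain ⟨C, hC⟩ := hM.exists_abs_J_le ht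
    rw [hM.zeta_eq hp, hM.zeta_eq hp, ← integral_sub
      (hM.integrable_of_abs_le hp (hmeas _) hC) (hM.integrable_J_Phi₁ lam ht hp)]
    refine (norm_integral_le_of_norm_le_const
      (f := fun y => M.J (t + 1) y - (Phi₁ M D lam).J (t + 1) y)
      ((hM.ae_mem_S hp).mono fun y hy => ih ht1 hR hy (by omega))).trans ?_
    simp

end IsApproximable

/-! ### Integrals over partitions -/

section Partition

theorem PartitionData.pairwise_disjoint_cell {Z : Type*} (P : PartitionData Z)
    (Y s : Set Z) :
    s.Pairwise (Function.onFun Disjoint (P.cell Y)) := fun _ _ _ _ hyz =>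
  Set.disjoint_left.2 fun _ h h' => hyz (h.2.symm.trans h'.2)

variable {Z : Type*} [MetricSpace Z] {Y : Set Z} {β : ℝ} {P : PartitionData Z}

theorem IsPartition.iUnion_cell (hP : IsPartition Y β P) : ⋃ y ∈ P.pts, P.cell Y y = Y := by
  ext x
  simp only [mem_iUnion, PartitionData.cell, mem_ofPred_eq, exists_prop]
  exact ⟨fun ⟨_, _, h, _⟩ => h, fun h => ⟨P.proj x, hP.proj_mem x h, h, rfl⟩⟩

variable [MeasurableSpace Z]

theorem IsPartition.integrableOn_comp_proj (hP : IsPartition Y β P)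
    (hm : ∀ y ∈ P.pts, MeasurableSet (P.cell Y y)) (μ : Measure Z) [IsFiniteMeasure μ]
    (f : Z → ℝ) : IntegrableOn (fun x => f (P.proj x)) Y μ := by
  rw [← hP.iUnion_cell]
  refine (integrableOn_finset_iUnion (s := P.pts)).2 fun y hy => ?_
  exact (integrableOn_const (measure_ne_top μ _)).congr_fun
    (fun x hx => by rw [hx.2] : EqOn (fun _ => f y) _ _) (hm y hy)

/-- Integrating against the discretized law amounts to integrating, against the law itself, the
function that is constant on the cells. -/
theorem IsPartition.integral_sum_dirac [BorelSpace Z] (hP : IsPartition Y β P)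
    (hm : ∀ y ∈ P.pts, MeasurableSet (P.cell Y y)) (μ : Measure Z) [IsFiniteMeasure μ]
    (f : Z → ℝ) :
    ∫ z in (P.pts : Set Z), f z ∂(∑ y ∈ P.pts, μ (P.cell Y y) • Measure.dirac y) =
      ∫ x in Y, f (P.proj x) ∂μ := by
  have hpts : MeasurableSet (P.pts : Set Z) := P.pts.measurableSet
  have hae : ∀ᵐ z ∂(∑ y ∈ P.pts, μ (P.cell Y y) • Measure.dirac y), z ∈ (P.pts : Set Z) := by
    rw [ae_iff]
    change (∑ y ∈ P.pts, μ (P.cell Y y) • Measure.dirac y) (P.pts : Set Z)ᶜ = 0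
    rw [Measure.finsetSum_apply]
    refine Finset.sum_eq_zero fun y hy => ?_
    simp [Measure.dirac_apply' _ hpts.compl, hy]
  rw [Measure.restrict_eq_self_of_ae_mem hae]
  have hfin : ∀ y, μ (P.cell Y y) ≠ ⊤ := fun y => measure_ne_top μ _
  calc ∫ z, f z ∂(∑ y ∈ P.pts, μ (P.cell Y y) • Measure.dirac y)
      = ∑ y ∈ P.pts, (μ (P.cell Y y)).toReal * f y := by
        rw [integral_finsetSum_measure fun y _ =>
          (integrable_dirac (by simp)).smul_measure (hfin y)]
        simp [integral_smul_measure]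
    _ = ∑ y ∈ P.pts, ∫ x in P.cell Y y, f (P.proj x) ∂μ := by
        refine Finset.sum_congr rfl fun y hy => ?_
        rw [setIntegral_congr_fun (hm y hy)
          (fun x hx => congrArg f hx.2 : EqOn (fun x => f (P.proj x)) (fun _ => f y) _)]
        simp [Measure.real]
    _ = ∫ x in ⋃ y ∈ P.pts, P.cell Y y, f (P.proj x) ∂μ := by
        refine (integral_biUnion_finset P.pts hm (P.pairwise_disjoint_cell Y _)
          fun y hy => ?_).symm
        refine (hP.integrableOn_comp_proj hm μ f).mono_set fun x hx => hx.1
    _ = ∫ x in Y, f (P.proj x) ∂μ := by rw [hP.iUnion_cell]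

end Partition

/-! ### The error of discretization -/

theorem sum_Icc_one_succ (f : ℕ → ℝ) (n : ℕ) :
    ∑ i ∈ Finset.Icc 1 (n + 1), f i = f 1 + ∑ i ∈ Finset.Icc 1 n, f (i + 1) := by
  induction n with
  | zero => simp
  | succ n ih =>
    rw [Finset.sum_Icc_succ_top (by omega), ih, Finset.sum_Icc_succ_top (by omega)]
    ring

namespace IsApproximable

variable {𝒜 : Type*} [MetricSpace 𝒜] [MeasurableSpace 𝒜]
  {M : MDPTuple (EuclideanSpace ℝ (Fin m)) 𝒜} {D : ApproxData m}
  {α β η lam : ℝ} {H : ℕ → Set (EuclideanSpace ℝ (Fin m))}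
  {Γ : ℕ → PartitionData (EuclideanSpace ℝ (Fin m))}
  {Θ : ℕ → EuclideanSpace ℝ (Fin m) → PartitionData 𝒜}

/-- Discretizing the transition law costs `α‖J̃_{t+1}‖_w`, for the mass outside `H_{t+1}`, on top
of the error `e` already present on `H_{t+1}`. -/
theorem abs_zeta_sub_setIntegral_le (hM : IsApproximable M D) (hH : H ∈ compactFamilies M D.w α)
    (hΓ : IsDiscretization M H β η Γ Θ) {t : ℕ} (ht : t < M.T) {e : ℝ}
    {f : EuclideanSpace ℝ (Fin m) → ℝ}
    (he : ∀ y ∈ H (t + 1), |(Phi₁ M D lam).J (t + 1) y - f ((Γ (t + 1)).proj y)| ≤ e)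
    {x : EuclideanSpace ℝ (Fin m)} (hx : x ∈ H t) {a : 𝒜} (ha : a ∈ M.ψ t x) :
    |M.zeta ((Phi₁ M D lam).J (t + 1)) t (x, a)
        - ∫ y in H (t + 1), f ((Γ (t + 1)).proj y) ∂(M.Q t x a)| ≤
      α * wNorm (M.S (t + 1)) D.w ((Phi₁ M D lam).J (t + 1)) + e := by
  set v := (Phi₁ M D lam).J (t + 1)
  have hp : (x, a) ∈ M.K t := ⟨(hH.1 t ht.le).2.2 hx, ha⟩
  have := hM.isMDP.Q_probability t (x, a) hp
  simp only at this
  have hHm : MeasurableSet (H (t + 1)) := (hH.1 (t + 1) ht).2.1.measurableSet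
  have hv : Integrable v (M.Q t x a) := hM.integrable_J_Phi₁ lam ht hp
  have hw : Integrable D.w (M.Q t x a) := hM.w_integrable t _ hp
  have hf := (hΓ.state (t + 1) ht).integrableOn_comp_proj (hΓ.state_measurable (t + 1) ht)
    (M.Q t x a) f
  have hn := wNorm_nonneg (s := M.S (t + 1)) (v := v) hM.w_pos
  obtain ⟨z, hz⟩ := (hH.1 (t + 1) ht).1
  have he0 : 0 ≤ e := (abs_nonneg _).trans (he z hz)
  have h1 : |∫ y in (H (t + 1))ᶜ, v y ∂(M.Q t x a)| ≤ α * wNorm (M.S (t + 1)) D.w v :=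
    calc |∫ y in (H (t + 1))ᶜ, v y ∂(M.Q t x a)|
        ≤ ∫ y in (H (t + 1))ᶜ, wNorm (M.S (t + 1)) D.w v * D.w y ∂(M.Q t x a) :=
          norm_integral_le_of_norm_le (f := v) (hw.const_mul _).integrableOn
            (ae_restrict_of_ae ((hM.ae_mem_S hp).mono fun y hy =>
              (hM.finiteWNorm_J_Phi₁ lam ht).abs_le hM.w_pos hy))
      _ = wNorm (M.S (t + 1)) D.w v * ∫ y in (H (t + 1))ᶜ, D.w y ∂(M.Q t x a) :=
          integral_const_mul _ _
      _ ≤ wNorm (M.S (t + 1)) D.w v * α :=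
          mul_le_mul_of_nonneg_left (hH.2 t ht x hx a ha) hn
      _ = _ := mul_comm _ _
  have h2 : |∫ y in H (t + 1), (v y - f ((Γ (t + 1)).proj y)) ∂(M.Q t x a)| ≤ e := by
    refine (norm_setIntegral_le_of_norm_le_const (f := fun y => v y - f ((Γ (t + 1)).proj y))
      (measure_lt_top _ _) he).trans ?_
    exact mul_le_of_le_one_right he0 measureReal_le_one
  rw [integral_sub hv.integrableOn hf] at h2
  have h3 := integral_add_compl hHm hv
  rw [hM.zeta_eq hp, ← h3]
  refine le_trans (le_of_eq ?_) ((abs_add_le _ _).trans (add_le_add h1 h2))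
  congr 1
  ring

/-- The backward recursion for the error of discretization. -/
theorem abs_J_Phi₁_sub_extendedJ_succ_le (hM : IsApproximable M D)
    (hH : H ∈ compactFamilies M D.w α) (hΓ : IsDiscretization M H β η Γ Θ) {t : ℕ}
    (ht : t < M.T) {e : ℝ}
    (he : ∀ y ∈ H (t + 1),
      |(Phi₁ M D lam).J (t + 1) y - extendedJ Γ (Psi M D lam H Γ Θ) (t + 1) y| ≤ e)
    {x : EuclideanSpace ℝ (Fin m)} (hx : x ∈ H t) :
    |(Phi₁ M D lam).J t x - extendedJ Γ (Psi M D lam H Γ Θ) t x| ≤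
      β * lipConst (M.S t) ((Phi₁ M D lam).J t) +
      η * (D.Lq * lipConst (M.S (t + 1)) ((Phi₁ M D lam).J (t + 1)) + lipConst₂ M.Kfull M.c) +
      α * wNorm (M.S (t + 1)) D.w ((Phi₁ M D lam).J (t + 1)) + e := by
  set v := (Phi₁ M D lam).J (t + 1) with hv
  set V := Psi M D lam H Γ Θ with hV
  set z := (Γ t).proj x with hz
  have hzΓ : z ∈ (Γ t).pts := (hΓ.state t ht.le).proj_mem x hx
  have hzH : z ∈ H t := (hΓ.state t ht.le).pts_subset z hzΓ
  have hxS : x ∈ M.S t := (hH.1 t ht.le).2.2 hx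
  have hzS : z ∈ M.S t := (hH.1 t ht.le).2.2 hzH
  have hvb := hM.exists_abs_J_Phi₁_le lam ht
  have hvL := lipschitzOnWith_lipConst (hM.exists_lipschitzOnWith_J_Phi₁ lam ht)
  have hΘ := hΓ.control t ht z hzΓ
  have hq := hM.Lq_pos
  -- moving the state to the point of its cell
  have h1 : |(Phi₁ M D lam).J t x - (Phi₁ M D lam).J t z| ≤
      β * lipConst (M.S t) ((Phi₁ M D lam).J t) := by
    refine ((lipschitzOnWith_lipConst
      (hM.exists_lipschitzOnWith_J_Phi₁ lam ht.le)).dist_le_mul x hxS z hzS).trans ?_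
    rw [mul_comm]
    exact mul_le_mul_of_nonneg_right ((hΓ.state t ht.le).dist_le x hx) (NNReal.coe_nonneg _)
  have hrec : V.J t z = ⨅ a : ((Θ t z).pts : Set 𝒜), (M.c z a +
      ∫ y in H (t + 1), V.J (t + 1) ((Γ (t + 1)).proj y) ∂(M.Q t z a)) := by
    rw [V.J_bellman (show t < V.T from ht)]
    refine iInf_congr fun a => ?_
    have ha : (a : 𝒜) ∈ M.ψ t z := hΘ.pts_subset a a.2
    have := hM.isMDP.Q_probability t (z, (a : 𝒜)) ⟨hzS, ha⟩
    simp only at this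
    exact congrArg (M.c z a + ·) ((hΓ.state (t + 1) ht).integral_sum_dirac
      (hΓ.state_measurable (t + 1) ht) (M.Q t z a) (V.J (t + 1)))
  have hQ : ∀ a ∈ M.ψ t z, |M.zeta v t (z, a) -
      ∫ y in H (t + 1), V.J (t + 1) ((Γ (t + 1)).proj y) ∂(M.Q t z a)| ≤
        α * wNorm (M.S (t + 1)) D.w v + e := fun a ha =>
    hM.abs_zeta_sub_setIntegral_le hH hΓ ht he hzH ha
  have hne := hM.nonempty_ψ t z
  obtain ⟨a₀⟩ := hM.nonempty_ψ t z
  -- `η` bounds a distance, so that its sign need not be assumed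
  have hη0 : 0 ≤ η := dist_nonneg.trans (hΘ.dist_le a₀ a₀.2)
  have hne' : Nonempty ((Θ t z).pts : Set 𝒜) := ⟨⟨_, hΘ.proj_mem a₀ a₀.2⟩⟩
  -- restricting the controls to the points of the partition and discretizing the law
  have h2 : |(Phi₁ M D lam).J t z - V.J t z| ≤
      η * (D.Lq * lipConst (M.S (t + 1)) v + lipConst₂ M.Kfull M.c) +
      (α * wNorm (M.S (t + 1)) D.w v + e) := by
    rw [J_Phi₁_eq_bellman M D lam ht, hrec, ← hv]
    refine abs_iInf_sub_iInf_le (hM.bddBelow_cost hvb hzS) (finite_range _).bddBelow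
      (fun a => ?_) fun a => ?_
    · have ha' := hΘ.proj_mem a a.2
      have haψ := hΘ.pts_subset _ ha'
      refine ⟨⟨_, ha'⟩, ?_⟩
      have h3 := hM.abs_zeta_sub_zeta_le hvb hvL (p := (z, (a : 𝒜)))
        (q := (z, (Θ t z).proj a)) ⟨hzS, a.2⟩ ⟨hzS, haψ⟩
      have h4 := isLipConst₂_lipConst₂ hM.c_lipschitz (z, (a : 𝒜))
        (hM.ψ_eq t ▸ a.2 : (a : 𝒜) ∈ M.ψ 0 z) (z, (Θ t z).proj a)
        (hM.ψ_eq t ▸ haψ : (Θ t z).proj a ∈ M.ψ 0 z)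
      simp only [dist_self, zero_add] at h3 h4
      have h5 : (D.Lq * lipConst (M.S (t + 1)) v + lipConst₂ M.Kfull M.c) *
          dist (a : 𝒜) ((Θ t z).proj a) ≤
          (D.Lq * lipConst (M.S (t + 1)) v + lipConst₂ M.Kfull M.c) * η :=
        mul_le_mul_of_nonneg_left (hΘ.dist_le a a.2) (by positivity)
      have h6 := (abs_le.1 h3).1
      have h7 := (abs_le.1 h4).1
      have h8 := (abs_le.1 (hQ _ haψ)).1
      linarith
    · have haψ : (a : 𝒜) ∈ M.ψ t z := hΘ.pts_subset a a.2
      refine ⟨⟨a, haψ⟩, ?_⟩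
      have h5 : 0 ≤ η * (D.Lq * lipConst (M.S (t + 1)) v + lipConst₂ M.Kfull M.c) := by
        positivity
      have h8 := (abs_le.1 (hQ a haψ)).2
      simp only
      linarith
  have h3 := abs_sub_le ((Phi₁ M D lam).J t x) ((Phi₁ M D lam).J t z) (V.J t z)
  change |(Phi₁ M D lam).J t x - V.J t z| ≤ _
  linarith

/-- The errors of the single steps add up. At the terminal time the error is that of moving the
state to the point of its cell in `h₁ + h̃_λ`. -/
theorem abs_J_Phi₁_sub_extendedJ_le (hM : IsApproximable M D)
    (hH : H ∈ compactFamilies M D.w α) (hΓ : IsDiscretization M H β η Γ Θ) {t k : ℕ}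
    (htk : t + k = M.T) {x : EuclideanSpace ℝ (Fin m)} (hx : x ∈ H t) :
    |(Phi₁ M D lam).J t x - extendedJ Γ (Psi M D lam H Γ Θ) t x| ≤
      α * (∑ i ∈ Finset.Icc 1 k, wNorm (M.S (t + i)) D.w ((Phi₁ M D lam).J (t + i))) +
      η * (D.Lq * (∑ i ∈ Finset.Icc 1 k,
            (lipConst (M.S (t + i)) ((Phi₁ M D lam).J (t + i)) : ℝ)) +
          (k : ℝ) * (lipConst₂ M.Kfull M.c : ℝ)) +
      β * ((lipConst Set.univ D.h₁ : ℝ) + (lipConst Set.univ (D.hTilde lam) : ℝ) +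
          ∑ i ∈ Finset.Icc 1 k,
            (lipConst (M.S (t + i - 1)) ((Phi₁ M D lam).J (t + i - 1)) : ℝ)) := by
  induction k generalizing t x with
  | zero =>
    obtain rfl : t = M.T := htk
    have hT : (Psi M D lam H Γ Θ).J M.T = fun x => D.h₁ x + D.hTilde lam x :=
      (Psi M D lam H Γ Θ).J_terminal
    rw [extendedJ, hT, J_Phi₁_terminal]
    have hd := (hΓ.state M.T le_rfl).dist_le x hx
    set z := (Γ M.T).proj x
    obtain ⟨L₁, hL₁⟩ := hM.h₁_lipschitz
    obtain ⟨L₂, hL₂⟩ := hM.exists_lipschitzWith_hTilde lam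
    have h1 := (lipschitzOnWith_lipConst ⟨L₁, hL₁.lipschitzOnWith⟩).dist_le_mul
      x (mem_univ x) z (mem_univ z)
    have h2 := (lipschitzOnWith_lipConst ⟨L₂, hL₂.lipschitzOnWith⟩).dist_le_mul
      x (mem_univ x) z (mem_univ z)
    rw [Real.dist_eq] at h1 h2
    have h3 : ((lipConst univ D.h₁ : ℝ) + lipConst univ (D.hTilde lam)) * dist x z ≤
        ((lipConst univ D.h₁ : ℝ) + lipConst univ (D.hTilde lam)) * β :=
      mul_le_mul_of_nonneg_left hd (by positivity)
    have h4 := abs_add_le (D.h₁ x - D.h₁ z) (D.hTilde lam x - D.hTilde lam z)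
    rw [show D.h₁ x + D.hTilde lam x - (D.h₁ z + D.hTilde lam z) =
      D.h₁ x - D.h₁ z + (D.hTilde lam x - D.hTilde lam z) by ring]
    simp
    linarith
  | succ k ih =>
    have h := hM.abs_J_Phi₁_sub_extendedJ_succ_le hH hΓ (lam := lam) (t := t) (by omega)
      (fun y hy => ih (t := t + 1) (by omega) hy) hx
    refine h.trans (le_of_eq ?_)
    have e1 : ∀ i, t + 1 + i = t + (i + 1) := fun i => by omega
    simp only [sum_Icc_one_succ, e1]
    push_cast
    ring

end IsApproximable

end SmoothMDP

theorem mainTheorem1 {m : ℕ} {𝒜 : Type*} [MetricSpace 𝒜] [MeasurableSpace 𝒜] [BorelSpace 𝒜]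
    [SecondCountableTopology 𝒜] [LocallyCompactSpace 𝒜]
    (M : SmoothMDP.MDPTuple (EuclideanSpace ℝ (Fin m)) 𝒜) (D : SmoothMDP.ApproxData m)
    (hM : SmoothMDP.IsApproximable M D)
    (α β η θ : ℝ) (hα : 0 < α) (hβ : 0 < β) (hη : 0 < η ∨ (η = 0 ∧ Subsingleton 𝒜))
    (hθ : 0 < θ) :
    ∃ (H : ℕ → Set (EuclideanSpace ℝ (Fin m))) (Λ : ℝ), 0 < Λ ∧
      (∀ lam : ℝ, 0 < lam → H ∈ SmoothMDP.compactFamilies (SmoothMDP.Phi₁ M D lam) D.w α) ∧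
      ∀ lam : ℝ, Λ < lam →
        (∀ t ≤ M.T,
          SmoothMDP.FiniteWNorm (M.S t) D.w (M.J t) ∧
          SmoothMDP.FiniteWNorm (M.S t) D.w ((SmoothMDP.Phi₁ M D lam).J t) ∧
          ∃ L : ℝ≥0, LipschitzOnWith L ((SmoothMDP.Phi₁ M D lam).J t) (M.S t)) ∧
        ∀ (Γ : ℕ → SmoothMDP.PartitionData (EuclideanSpace ℝ (Fin m)))
          (Θ : ℕ → EuclideanSpace ℝ (Fin m) → SmoothMDP.PartitionData 𝒜),
          SmoothMDP.IsDiscretization M H β η Γ Θ →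
          ∀ t < M.T, ∀ x ∈ H t,
            |M.J t x - SmoothMDP.extendedJ Γ (SmoothMDP.Psi M D lam H Γ Θ) t x| ≤
              θ * (SmoothMDP.wNorm (M.S M.T) D.w (M.J M.T) +
                  SmoothMDP.wNorm (M.S M.T) D.w ((SmoothMDP.Phi₁ M D lam).J M.T)) +
              α * (∑ i ∈ Finset.Icc 1 (M.T - t),
                  SmoothMDP.wNorm (M.S (t + i)) D.w ((SmoothMDP.Phi₁ M D lam).J (t + i))) +
              η * (D.Lq * (∑ i ∈ Finset.Icc 1 (M.T - t),
                    (SmoothMDP.lipConst (M.S (t + i))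
                      ((SmoothMDP.Phi₁ M D lam).J (t + i)) : ℝ)) +
                  ((M.T - t : ℕ) : ℝ) * (SmoothMDP.lipConst₂ M.Kfull M.c : ℝ)) +
              β * ((SmoothMDP.lipConst Set.univ D.h₁ : ℝ) +
                  (SmoothMDP.lipConst Set.univ (D.hTilde lam) : ℝ) +
                  ∑ i ∈ Finset.Icc 1 (M.T - t),
                    (SmoothMDP.lipConst (M.S (t + i - 1))
                      ((SmoothMDP.Phi₁ M D lam).J (t + i - 1)) : ℝ)) := by
  obtain ⟨H, hH⟩ := hM.exists_mem_compactFamilies hα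
  obtain ⟨Λ, hΛ, hR⟩ := hM.region_small θ hθ
  -- the defining conditions of the compact families do not mention the terminal cost
  refine ⟨H, Λ, hΛ, fun lam _ => hH, fun lam hlam => ⟨fun t ht =>
    ⟨hM.finiteWNorm_J ht, hM.finiteWNorm_J_Phi₁ lam ht, hM.exists_lipschitzOnWith_J_Phi₁ lam ht⟩,
    fun Γ Θ hΓ t ht x hx => ?_⟩⟩
  have h1 := hM.abs_J_sub_J_Phi₁_le ht (fun s hs p hp => (hR lam hlam s hs p hp).le)
    ((hH.1 t ht.le).2.2 hx)
  have h2 := hM.abs_J_Phi₁_sub_extendedJ_le (lam := lam) hH hΓ (Nat.add_sub_cancel' ht.le) hx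
  have h3 := abs_sub_le (M.J t x) ((SmoothMDP.Phi₁ M D lam).J t x)
    (SmoothMDP.extendedJ Γ (SmoothMDP.Psi M D lam H Γ Θ) t x)
  linarith
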